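/- Let $E$ be a complex operator space, i.e. a complex normed space with norms on all the matrix spaces $M_n(E)$ satisfying Ruan's axioms (equivalently, up to complete isometry, a linear subspace of some $B(H)$); completeness is not needed. For a linear map $u$ between operator spaces, $\|u\|_{cb}\in[0,\infty]$ is its completely bounded norm. For a set $I$, $OH(I)$ is Pisier's operator Hilbert space: the Hilbert space $\ell_2(I)$ with the matrix norms determined by $\|\sum_s a_s\otimes e_s\|=\|\sum_s a_s\otimes\overline{a_s}\|^{1/2}$ for finitely supported families of scalar matrices $a_s$, where $(e_s)_{s\in I}$ is the canonical orthonormal basis. For a linear map $w:E\to Y$ into a normed space, $\pi_{2,oh}(w)\in[0,\infty]$ is the least $C$ such that $\sum_i\|w(x_i)\|^2\le C^2\,\|\sum_i x_i\otimes\overline{x_i}\|_{E\otimes_{\min}\overline{E}}$ for all finite sequences $(x_i)$ in $E$. For a linear map $T:E\to E$ put $\delta(T)=\inf\|v\|_{cb}\,\pi_{2,oh}(w)\in[0,\infty]$, the infimum being over all factorizations $T=vw$ with linear maps $w:E\to OH(I)$, $v:OH(I)\to E$ through some $OH(I)$. Let $K\ge 1$ be a real number and $k:\mathbb{N}\to[0,\infty)$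 a function. We say that $E$ has the $(K,k(n))$-OUAP (respectively the $(K,k(n))$-$\delta$-OUAP) if for every $n$ and every $n$-dimensional subspace $M\subseteq E$ there is a finite rank linear map $T:E\to E$ with $\|T\|_{cb}\le K$, $T|_M=\mathrm{id}_M$ and $\operatorname{rank}T\le k(n)$ (respectively $\delta(T)\le k(n)$). **Lemma.** If $E$ has the $(K,k(n))$-$\delta$-OUAP, then for every integer $m>1$ the space $E$ has the $$\Big(\frac{1}{1-1/m}\Big(\frac1m+K^{m+1}\Big),\; m^{2/m}\,k(n)^{2+2/m}\Big)\text{-OUAP}.$$ -/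

import Mathlib

open scoped NNReal ENNReal ComplexConjugate TensorProduct lp

noncomputable section

/-! ### Auxiliary facts on the operator norm of scalar matrices -/

namespace OperatorSpaceAux

open Matrix
open scoped Matrix.Norms.L2Operator Kronecker ComplexOrder

set_option linter.unusedSectionVars false

section L2

variable {m n p q : Type*} [Fintype m] [Fintype n] [Fintype p] [Fintype q]
variable [DecidableEq m] [DecidableEq n] [DecidableEq p] [DecidableEq q]

lemma sq_mulVec_le (A : Matrix m n ℂ) (ξ : n → ℂ) :
    ∑ i, ‖∑ j, A i j * ξ j‖ ^ 2 ≤ ‖A‖ ^ 2 * ∑ j, ‖ξ j‖ ^ 2 := by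
  have h := A.l2_opNorm_mulVec (WithLp.toLp 2 ξ)
  have h2 := pow_le_pow_left₀ (norm_nonneg _) h 2
  rw [mul_pow, EuclideanSpace.norm_sq_eq, EuclideanSpace.norm_sq_eq] at h2
  exact h2

lemma norm_le_of_sq_mulVec_le (A : Matrix m n ℂ) {C : ℝ} (hC : 0 ≤ C)
    (h : ∀ ξ : n → ℂ, ∑ i, ‖∑ j, A i j * ξ j‖ ^ 2 ≤ C ^ 2 * ∑ j, ‖ξ j‖ ^ 2) : ‖A‖ ≤ C := by
  rw [l2_opNorm_def]
  refine ContinuousLinearMap.opNorm_le_bound _ hC fun ξ => ?_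
  refine (sq_le_sq₀ (norm_nonneg _) (by positivity)).mp ?_
  rw [mul_pow, EuclideanSpace.norm_sq_eq, EuclideanSpace.norm_sq_eq]
  exact h ξ.ofLp

lemma norm_sesq_le (A : Matrix m n ℂ) (η : m → ℂ) (ξ : n → ℂ) :
    ‖∑ i, ∑ j, conj (η i) * A i j * ξ j‖ ≤
      ‖A‖ * (√(∑ i, ‖η i‖ ^ 2) * √(∑ j, ‖ξ j‖ ^ 2)) := by
  have h1 : ∑ i, ∑ j, conj (η i) * A i j * ξ j = ∑ i, conj (η i) * ∑ j, A i j * ξ j := by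
    simp only [Finset.mul_sum, mul_assoc]
  rw [h1]
  calc ‖∑ i, conj (η i) * ∑ j, A i j * ξ j‖
      ≤ ∑ i, ‖η i‖ * ‖∑ j, A i j * ξ j‖ := by
        refine (norm_sum_le _ _).trans (le_of_eq ?_)
        simp
    _ ≤ √(∑ i, ‖η i‖ ^ 2) * √(∑ i, ‖∑ j, A i j * ξ j‖ ^ 2) :=
        Real.sum_mul_le_sqrt_mul_sqrt _ _ _
    _ ≤ √(∑ i, ‖η i‖ ^ 2) * √(‖A‖ ^ 2 * ∑ j, ‖ξ j‖ ^ 2) := by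
        gcongr
        exact sq_mulVec_le A ξ
    _ = _ := by
        rw [Real.sqrt_mul (by positivity), Real.sqrt_sq (norm_nonneg _)]
        ring

lemma norm_le_of_sesq_le (A : Matrix m n ℂ) {C : ℝ} (hC : 0 ≤ C)
    (h : ∀ (η : m → ℂ) (ξ : n → ℂ), ‖∑ i, ∑ j, conj (η i) * A i j * ξ j‖ ≤
      C * (√(∑ i, ‖η i‖ ^ 2) * √(∑ j, ‖ξ j‖ ^ 2))) : ‖A‖ ≤ C := by
  refine norm_le_of_sq_mulVec_le A hC fun ξ => ?_
  have h1 := h (fun i => ∑ j, A i j * ξ j) ξ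
  set s := ∑ i, ‖∑ j, A i j * ξ j‖ ^ 2 with hs
  have hs0 : 0 ≤ s := by positivity
  have ht0 : 0 ≤ ∑ j, ‖ξ j‖ ^ 2 := by positivity
  have h2 : ∑ i, ∑ j, conj (∑ j, A i j * ξ j) * A i j * ξ j = (s : ℂ) := by
    rw [hs]
    push_cast
    refine Finset.sum_congr rfl fun i _ => ?_
    rw [← Complex.conj_mul', Finset.mul_sum]
    simp only [mul_assoc]
  rw [h2, Complex.norm_real, Real.norm_of_nonneg hs0] at h1
  rcases hs0.eq_or_lt with h0 | h0
  · rw [← h0]; positivity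
  · have h3 : √s ≤ C * √(∑ j, ‖ξ j‖ ^ 2) := by
      have hpos := Real.sqrt_pos.mpr h0
      have h4 : √s * √s ≤ √s * (C * √(∑ j, ‖ξ j‖ ^ 2)) := by
        rw [Real.mul_self_sqrt hs0]; linarith
      exact le_of_mul_le_mul_left h4 hpos
    have h5 := pow_le_pow_left₀ (Real.sqrt_nonneg _) h3 2
    rwa [mul_pow, Real.sq_sqrt hs0, Real.sq_sqrt ht0] at h5

lemma norm_submatrix_le (A : Matrix m n ℂ) (e : p ≃ m) (f : q ≃ n) :
    ‖A.submatrix e f‖ ≤ ‖A‖ := by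
  refine norm_le_of_sq_mulVec_le _ (norm_nonneg _) fun ξ => ?_
  have h := sq_mulVec_le A (ξ ∘ f.symm)
  rw [← e.sum_comp, ← f.sum_comp] at h
  simp only [← f.sum_comp (fun j => A _ j * _), Function.comp, Equiv.symm_apply_apply] at h
  exact h

lemma norm_submatrix (A : Matrix m n ℂ) (e : p ≃ m) (f : q ≃ n) :
    ‖A.submatrix e f‖ = ‖A‖ := by
  refine le_antisymm (norm_submatrix_le A e f) ?_
  have h := norm_submatrix_le (A.submatrix e f) e.symm f.symm
  simpa using h

lemma norm_map_conj (A : Matrix m n ℂ) : ‖A.map conj‖ = ‖A‖ := by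
  have key : ∀ B : Matrix m n ℂ, ‖B.map conj‖ ≤ ‖B‖ := fun B => by
    refine norm_le_of_sq_mulVec_le _ (norm_nonneg _) fun ξ => ?_
    have h := sq_mulVec_le B (fun j => conj (ξ j))
    simp only [RCLike.norm_conj] at h
    refine le_trans (le_of_eq ?_) h
    refine Finset.sum_congr rfl fun i _ => ?_
    rw [← RCLike.norm_conj (∑ j, B i j * conj (ξ j))]
    simp
  refine le_antisymm (key A) ?_
  have h := key (A.map conj)
  simpa [Matrix.map_map, Function.comp_def] using h

lemma norm_kronecker_le (A : Matrix m n ℂ) (B : Matrix p q ℂ) : ‖A ⊗ₖ B‖ ≤ ‖A‖ * ‖B‖ := by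
  refine norm_le_of_sq_mulVec_le _ (by positivity) fun ξ => ?_
  simp only [Fintype.sum_prod_type, kroneckerMap_apply]
  calc ∑ i, ∑ k, ‖∑ j, ∑ l, A i j * B k l * ξ (j, l)‖ ^ 2
      = ∑ k, ∑ i, ‖∑ j, A i j * ∑ l, B k l * ξ (j, l)‖ ^ 2 := by
        rw [Finset.sum_comm]
        simp only [Finset.mul_sum, mul_assoc]
    _ ≤ ∑ k, ‖A‖ ^ 2 * ∑ j, ‖∑ l, B k l * ξ (j, l)‖ ^ 2 :=
        Finset.sum_le_sum fun k _ => sq_mulVec_le A _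
    _ = ‖A‖ ^ 2 * ∑ j, ∑ k, ‖∑ l, B k l * ξ (j, l)‖ ^ 2 := by
        rw [← Finset.mul_sum, Finset.sum_comm]
    _ ≤ ‖A‖ ^ 2 * ∑ j, ‖B‖ ^ 2 * ∑ l, ‖ξ (j, l)‖ ^ 2 := by
        gcongr with j
        exact sq_mulVec_le B _
    _ = _ := by rw [← Finset.mul_sum, mul_pow, mul_assoc]

lemma norm_one_le : ‖(1 : Matrix n n ℂ)‖ ≤ 1 :=
  norm_le_of_sq_mulVec_le _ zero_le_one fun ξ => by simp [Matrix.one_apply]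

lemma norm_fromBlocks_le (A : Matrix m n ℂ) (B : Matrix p q ℂ) :
    ‖fromBlocks A 0 0 B‖ ≤ max ‖A‖ ‖B‖ := by
  have h0 : 0 ≤ max ‖A‖ ‖B‖ := le_max_of_le_left (norm_nonneg _)
  refine norm_le_of_sq_mulVec_le _ h0 fun ξ => ?_
  simp only [Fintype.sum_sum_type, fromBlocks_apply₁₁, fromBlocks_apply₁₂, fromBlocks_apply₂₁,
    fromBlocks_apply₂₂, Matrix.zero_apply, zero_mul, Finset.sum_const_zero, add_zero, zero_add, mul_add]
  refine add_le_add ?_ ?_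
  · refine (sq_mulVec_le A _).trans ?_
    gcongr
    exact le_max_left _ _
  · refine (sq_mulVec_le B _).trans ?_
    gcongr
    exact le_max_right _ _

/-- Every matrix is a product `P Qᴴ` with `PᴴP = QᴴQ`. -/
lemma exists_factor (ξ : Matrix m n ℂ) :
    ∃ (P : Matrix m n ℂ) (Q : Matrix n n ℂ), ξ = P * Qᴴ ∧ Pᴴ * P = Qᴴ * Q := by
  have hH : (ξᴴ * ξ).IsHermitian := isHermitian_conjTranspose_mul_self ξ
  have hpos : ∀ i, 0 ≤ hH.eigenvalues i := (posSemidef_conjTranspose_mul_self ξ).eigenvalues_nonneg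
  set V : Matrix n n ℂ := (hH.eigenvectorUnitary : Matrix n n ℂ) with hV
  have hVV : V * Vᴴ = 1 := Unitary.coe_mul_star_self hH.eigenvectorUnitary
  have hVV' : Vᴴ * V = 1 := Unitary.coe_star_mul_self hH.eigenvectorUnitary
  set t : n → ℝ := fun i => √(√(hH.eigenvalues i)) with ht
  have ht4 : ∀ i, t i ^ 4 = hH.eigenvalues i := fun i => by
    have h1 : t i ^ 2 = √(hH.eigenvalues i) := Real.sq_sqrt (Real.sqrt_nonneg _)
    rw [show t i ^ 4 = (t i ^ 2) ^ 2 by ring, h1, Real.sq_sqrt (hpos i)]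
  set W : Matrix m n ℂ := ξ * V with hW
  have hWW : Wᴴ * W = diagonal (fun i => ((t i : ℂ)) ^ 4) := by
    have hs := hH.spectral_theorem
    rw [Unitary.conjStarAlgAut_apply] at hs
    have : Wᴴ * W = Vᴴ * (ξᴴ * ξ) * V := by
      rw [hW, conjTranspose_mul]; simp only [Matrix.mul_assoc]
    rw [this, hs]
    change Vᴴ * (V * _ * Vᴴ) * V = _
    rw [show ∀ D : Matrix n n ℂ, Vᴴ * (V * D * Vᴴ) * V = (Vᴴ * V) * D * (Vᴴ * V) by
      intro D; simp only [Matrix.mul_assoc], hVV', Matrix.one_mul, Matrix.mul_one]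
    congr 1
    funext i
    simp only [Function.comp, ← ht4 i]
    push_cast
    rfl
  have hWz : ∀ i j, t j = 0 → W i j = 0 := fun i j hj => by
    have h1 : (Wᴴ * W) j j = 0 := by rw [hWW]; simp [hj]
    rw [mul_apply] at h1
    have h2 : ∑ i, ‖W i j‖ ^ 2 = 0 := by
      have h3 : ((∑ i, ‖W i j‖ ^ 2 : ℝ) : ℂ) = 0 := by
        rw [← h1]
        push_cast
        refine Finset.sum_congr rfl fun i _ => ?_
        rw [conjTranspose_apply, ← Complex.conj_mul']
        rfl
      exact_mod_cast h3
    have h4 := (Finset.sum_eq_zero_iff_of_nonneg (fun i _ => by positivity)).mp h2 i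
      (Finset.mem_univ i)
    simpa using h4
  have hself : ∀ c : n → ℝ, (diagonal (fun i => (c i : ℂ)))ᴴ = diagonal (fun i => (c i : ℂ)) := by
    intro c
    rw [diagonal_conjTranspose]
    congr 1
    funext i
    exact Complex.conj_ofReal _
  refine ⟨W * diagonal (fun i => (((t i)⁻¹ : ℝ) : ℂ)), V * diagonal (fun i => ((t i : ℝ) : ℂ)),
    ?_, ?_⟩
  · rw [conjTranspose_mul, hself]
    have h1 : W * diagonal (fun i => (((t i)⁻¹ : ℝ) : ℂ)) * diagonal (fun i => ((t i : ℝ) : ℂ))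
        = W := by
      ext i j
      rw [mul_diagonal, mul_diagonal]
      by_cases hj : t j = 0
      · simp [hj, hWz i j hj]
      · have : ((t j : ℝ) : ℂ) ≠ 0 := by exact_mod_cast hj
        push_cast
        field_simp
    rw [← Matrix.mul_assoc, h1, hW, Matrix.mul_assoc, hVV, Matrix.mul_one]
  · rw [conjTranspose_mul W, conjTranspose_mul V, hself, hself]
    rw [show ∀ D : Matrix n n ℂ, D * Wᴴ * (W * D) = D * (Wᴴ * W) * D by
      intro D; simp only [Matrix.mul_assoc]]
    rw [show ∀ D : Matrix n n ℂ, D * Vᴴ * (V * D) = D * (Vᴴ * V) * D by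
      intro D; simp only [Matrix.mul_assoc]]
    rw [hWW, hVV', Matrix.mul_one, diagonal_mul_diagonal, diagonal_mul_diagonal,
      diagonal_mul_diagonal]
    congr 1
    funext i
    by_cases hj : t i = 0
    · simp [hj]
    · have : ((t i : ℝ) : ℂ) ≠ 0 := by exact_mod_cast hj
      push_cast
      field_simp

lemma sum_sq_eq_trace (ξ : Matrix m n ℂ) :
    ((∑ i, ∑ j, ‖ξ i j‖ ^ 2 : ℝ) : ℂ) = (ξᴴ * ξ).trace := by
  rw [Finset.sum_comm]
  simp only [trace, diag, mul_apply, conjTranspose_apply]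
  push_cast
  refine Finset.sum_congr rfl fun i _ => Finset.sum_congr rfl fun j _ => ?_
  rw [← Complex.conj_mul']
  rfl

lemma trace_mul_conjTranspose_sq (R : Matrix m n ℂ) :
    ((R * Rᴴ)ᴴ * (R * Rᴴ)).trace = ((Rᴴ * R) * (Rᴴ * R)).trace := by
  rw [conjTranspose_mul, conjTranspose_conjTranspose, Matrix.mul_assoc, trace_mul_comm]
  simp only [Matrix.mul_assoc]

lemma factor_sum_sq {ξ P : Matrix m n ℂ} {Q : Matrix n n ℂ} (h : ξ = P * Qᴴ) (h' : Pᴴ * P = Qᴴ * Q) :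
    ∑ i, ∑ j, ‖(P * Pᴴ) i j‖ ^ 2 = ∑ i, ∑ j, ‖ξ i j‖ ^ 2 ∧
    ∑ i, ∑ j, ‖(Q * Qᴴ) i j‖ ^ 2 = ∑ i, ∑ j, ‖ξ i j‖ ^ 2 := by
  have e0 : (ξᴴ * ξ).trace = ((Pᴴ * P) * (Pᴴ * P)).trace := by
    rw [h, conjTranspose_mul, conjTranspose_conjTranspose]
    rw [show Q * Pᴴ * (P * Qᴴ) = Q * ((Pᴴ * P) * Qᴴ) by simp only [Matrix.mul_assoc],
      trace_mul_comm, Matrix.mul_assoc, ← h']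
  constructor
  · have : ((∑ i, ∑ j, ‖(P * Pᴴ) i j‖ ^ 2 : ℝ) : ℂ) = ((∑ i, ∑ j, ‖ξ i j‖ ^ 2 : ℝ) : ℂ) := by
      rw [sum_sq_eq_trace, sum_sq_eq_trace, e0, trace_mul_conjTranspose_sq]
    exact_mod_cast this
  · have : ((∑ i, ∑ j, ‖(Q * Qᴴ) i j‖ ^ 2 : ℝ) : ℂ) = ((∑ i, ∑ j, ‖ξ i j‖ ^ 2 : ℝ) : ℂ) := by
      rw [sum_sq_eq_trace, sum_sq_eq_trace, e0, trace_mul_conjTranspose_sq, h']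
    exact_mod_cast this

end L2

section Gram

variable {H : Type*} [NormedAddCommGroup H] [InnerProductSpace ℂ H]
variable {ι κ ρ : Type*} [Fintype ι] [Fintype κ] [Fintype ρ]
variable [DecidableEq ι] [DecidableEq κ] [DecidableEq ρ]

/-- The matrix `[⟨x i j, y k l⟩]` with rows indexed by `(i, k)` and columns by `(j, l)`
(the inner product being linear in `x`).  If `x = ∑ s, a s ⊗ e s` and `y = ∑ s, b s ⊗ e s` with
scalar matrices `a s`, `b s` and `(e s)` orthonormal, this is `∑ s, a s ⊗ conj (b s)`. -/
def gram (x : Matrix ι ι H) (y : Matrix κ κ H) : Matrix (ι × κ) (ι × κ) ℂ :=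
  Matrix.of fun p q => inner ℂ (y p.2 q.2) (x p.1 q.1)

/-- The matrix `Rᴴ x P`. -/
def comb (R P : Matrix ι ρ ℂ) (x : Matrix ι ι H) (t r : ρ) : H :=
  ∑ i, ∑ j, (conj (R i t) * P j r) • x i j

lemma sum_reorder (F : ι → κ → ι → κ → ρ → ρ → ℂ) :
    ∑ i, ∑ k, ∑ j, ∑ l, ∑ t, ∑ r, F i k j l t r = ∑ t, ∑ r, ∑ i, ∑ j, ∑ k, ∑ l, F i k j l t r := by
  simp only [← Fintype.sum_prod_type']
  exact Fintype.sum_equiv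
    ⟨fun z => (z.2.2.2.2.1, z.2.2.2.2.2, z.1, z.2.2.1, z.2.1, z.2.2.2.1),
     fun z => (z.2.2.1, z.2.2.2.2.1, z.2.2.2.1, z.2.2.2.2.2, z.1, z.2.1),
     fun _ => rfl, fun _ => rfl⟩ _ _ (fun _ => rfl)

lemma gram_sesq (x : Matrix ι ι H) (y : Matrix κ κ H) (R P : Matrix ι ρ ℂ)
    (S Q : Matrix κ ρ ℂ) :
    ∑ p, ∑ q, conj ((R * Sᴴ) p.1 p.2) * gram x y p q * (P * Qᴴ) q.1 q.2 =
      ∑ t, ∑ r, inner ℂ (comb S Q y t r) (comb R P x t r) := by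
  have hL : ∑ p : ι × κ, ∑ q : ι × κ, conj ((R * Sᴴ) p.1 p.2) * gram x y p q * (P * Qᴴ) q.1 q.2 =
      ∑ i, ∑ k, ∑ j, ∑ l, ∑ t, ∑ r,
        conj (R i t) * S k t * P j r * conj (Q l r) * inner ℂ (y k l) (x i j) := by
    simp only [Fintype.sum_prod_type]
    refine Finset.sum_congr rfl fun i _ => Finset.sum_congr rfl fun k _ =>
      Finset.sum_congr rfl fun j _ => Finset.sum_congr rfl fun l _ => ?_
    simp only [mul_apply, conjTranspose_apply, gram, of_apply, map_sum, map_mul, Finset.sum_mul,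
      Finset.mul_sum]
    rw [Finset.sum_comm]
    refine Finset.sum_congr rfl fun t _ => Finset.sum_congr rfl fun r _ => ?_
    simp only [← starRingEnd_apply, Complex.conj_conj]
    ring
  rw [hL, sum_reorder]
  refine Finset.sum_congr rfl fun t _ => Finset.sum_congr rfl fun r _ => ?_
  simp only [comb, sum_inner, inner_sum, inner_smul_left, inner_smul_right, map_mul,
    Complex.conj_conj, Finset.mul_sum]
  refine Finset.sum_congr rfl fun i _ => Finset.sum_congr rfl fun j _ =>
    Finset.sum_congr rfl fun k _ => Finset.sum_congr rfl fun l _ => ?_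
  ring

lemma sum_comb_sq_le (x : Matrix ι ι H) (R P : Matrix ι ρ ℂ) :
    ∑ t, ∑ r, ‖comb R P x t r‖ ^ 2 ≤ ‖gram x x‖ *
      (√(∑ i, ∑ j, ‖(R * Rᴴ) i j‖ ^ 2) * √(∑ i, ∑ j, ‖(P * Pᴴ) i j‖ ^ 2)) := by
  have h := norm_sesq_le (gram x x) (fun p => (R * Rᴴ) p.1 p.2) (fun p => (P * Pᴴ) p.1 p.2)
  rw [gram_sesq] at h
  simp only [inner_self_eq_norm_sq_to_K, Fintype.sum_prod_type] at h
  refine le_trans ?_ h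
  have h0 : (0 : ℝ) ≤ ∑ t, ∑ r, ‖comb R P x t r‖ ^ 2 := by positivity
  rw [← Real.norm_of_nonneg h0, ← Complex.norm_real]
  push_cast
  exact le_rfl

/-- The Cauchy–Schwarz inequality `‖∑ a s ⊗ conj (b s)‖² ≤ ‖∑ a s ⊗ conj (a s)‖ ‖∑ b s ⊗ conj (b s)‖`. -/
lemma norm_gram_le (x : Matrix ι ι H) (y : Matrix κ κ H) : ‖gram x y‖ ≤ √‖gram x x‖ * √‖gram y y‖ := by
  refine norm_le_of_sesq_le _ (by positivity) fun η ξ => ?_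
  obtain ⟨R, S, hη, hη'⟩ := exists_factor (Matrix.of fun i k => η (i, k))
  obtain ⟨P, Q, hξ, hξ'⟩ := exists_factor (Matrix.of fun i k => ξ (i, k))
  obtain ⟨hR, hS⟩ := factor_sum_sq hη hη'
  obtain ⟨hP, hQ⟩ := factor_sum_sq hξ hξ'
  have e1 : ∀ p : ι × κ, η p = (R * Sᴴ) p.1 p.2 := fun p => by rw [← hη]; rfl
  have e2 : ∀ p : ι × κ, ξ p = (P * Qᴴ) p.1 p.2 := fun p => by rw [← hξ]; rfl
  have e3 : ∑ p, ‖η p‖ ^ 2 = ∑ i, ∑ k, ‖η (i, k)‖ ^ 2 := Fintype.sum_prod_type _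
  have e4 : ∑ p, ‖ξ p‖ ^ 2 = ∑ i, ∑ k, ‖ξ (i, k)‖ ^ 2 := Fintype.sum_prod_type _
  have hX := sum_comb_sq_le x R P
  have hY := sum_comb_sq_le y S Q
  rw [hR, hP] at hX
  rw [hS, hQ] at hY
  simp only [of_apply] at hX hY
  rw [← e3, ← e4] at hX hY
  have e5 : ∑ p, ∑ q, conj (η p) * gram x y p q * ξ q =
      ∑ t, ∑ r, inner ℂ (comb S Q y t r) (comb R P x t r) := by
    rw [← gram_sesq]
    simp only [e1, e2]
  rw [e5]
  set c := √(∑ p, ‖η p‖ ^ 2) * √(∑ p, ‖ξ p‖ ^ 2) with hc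
  have hc0 : 0 ≤ c := by positivity
  calc ‖∑ t, ∑ r, inner ℂ (comb S Q y t r) (comb R P x t r)‖
      ≤ ∑ p : κ × κ, ‖comb S Q y p.1 p.2‖ * ‖comb R P x p.1 p.2‖ := by
        rw [← Fintype.sum_prod_type' (fun t r => inner ℂ (comb S Q y t r) (comb R P x t r))]
        exact (norm_sum_le _ _).trans (Finset.sum_le_sum fun p _ => norm_inner_le_norm _ _)
    _ ≤ √(∑ p : κ × κ, ‖comb S Q y p.1 p.2‖ ^ 2) * √(∑ p : κ × κ, ‖comb R P x p.1 p.2‖ ^ 2) :=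
        Real.sum_mul_le_sqrt_mul_sqrt _ _ _
    _ ≤ √(‖gram y y‖ * c) * √(‖gram x x‖ * c) := by
        rw [Fintype.sum_prod_type, Fintype.sum_prod_type]
        gcongr
    _ = √‖gram x x‖ * √‖gram y y‖ * c := by
        rw [Real.sqrt_mul (norm_nonneg _), Real.sqrt_mul (norm_nonneg _)]
        have := Real.mul_self_sqrt hc0
        linear_combination (√‖gram y y‖ * √‖gram x x‖) * this

lemma gram_add_left (x x' : Matrix ι ι H) (y : Matrix κ κ H) : gram (x + x') y = gram x y + gram x' y := by
  ext p q
  simp [gram]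

lemma gram_add_right (x : Matrix ι ι H) (y y' : Matrix κ κ H) : gram x (y + y') = gram x y + gram x y' := by
  ext p q
  simp [gram]

lemma sqrt_norm_gram_add_le (x y : Matrix ι ι H) :
    √‖gram (x + y) (x + y)‖ ≤ √‖gram x x‖ + √‖gram y y‖ := by
  rw [Real.sqrt_le_left (by positivity), gram_add_left, gram_add_right, gram_add_right]
  have h1 := norm_gram_le x y
  have h2 := norm_gram_le y x
  have h3 := Real.sq_sqrt (norm_nonneg (gram x x))
  have h4 := Real.sq_sqrt (norm_nonneg (gram y y))
  calc ‖gram x x + gram x y + (gram y x + gram y y)‖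
      ≤ ‖gram x x‖ + ‖gram x y‖ + (‖gram y x‖ + ‖gram y y‖) :=
        (norm_add_le _ _).trans (add_le_add (norm_add_le _ _) (norm_add_le _ _))
    _ ≤ _ := by nlinarith

lemma sqrt_norm_gram_smul (c : ℂ) (x : Matrix ι ι H) :
    √‖gram (c • x) (c • x)‖ = ‖c‖ * √‖gram x x‖ := by
  have : gram (c • x) (c • x) = (conj c * c) • gram x x := by
    ext p q
    simp only [gram, of_apply, Matrix.smul_apply, inner_smul_left, inner_smul_right, smul_eq_mul]
    ring
  rw [this, norm_smul, norm_mul, RCLike.norm_conj, Real.sqrt_mul (by positivity),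
    Real.sqrt_mul_self (norm_nonneg _)]

lemma norm_gram_submatrix (x : Matrix ι ι H) (e : κ ≃ ι) :
    ‖gram (x.submatrix e e) (x.submatrix e e)‖ = ‖gram x x‖ :=
  norm_submatrix (gram x x) (e.prodCongr e) (e.prodCongr e)

lemma norm_gram_le_max (x : Matrix ι ι H)
    (y : Matrix κ κ H) : √‖gram x x‖ * √‖gram y y‖ ≤ max ‖gram x x‖ ‖gram y y‖ := by
  have h0 : 0 ≤ max ‖gram x x‖ ‖gram y y‖ := le_max_of_le_left (norm_nonneg _)
  rw [← Real.mul_self_sqrt h0]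
  gcongr
  · exact le_max_left _ _
  · exact le_max_right _ _

lemma norm_gram_fromBlocks_le (x : Matrix ι ι H) (y : Matrix κ κ H) :
    ‖gram (fromBlocks x 0 0 y) (fromBlocks x 0 0 y)‖ ≤ max ‖gram x x‖ ‖gram y y‖ := by
  have h0 : 0 ≤ max ‖gram x x‖ ‖gram y y‖ := le_max_of_le_left (norm_nonneg _)
  have hxy : ‖gram x y‖ ≤ max ‖gram x x‖ ‖gram y y‖ :=
    (norm_gram_le x y).trans (norm_gram_le_max x y)
  have hyx : ‖gram y x‖ ≤ max ‖gram x x‖ ‖gram y y‖ :=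
    (norm_gram_le y x).trans ((norm_gram_le_max y x).trans (le_of_eq (max_comm _ _)))
  refine norm_le_of_sq_mulVec_le _ h0 fun ξ => ?_
  have hxx := sq_mulVec_le (gram x x) (fun p => ξ (.inl p.1, .inl p.2))
  have hxy' := sq_mulVec_le (gram x y) (fun p => ξ (.inl p.1, .inr p.2))
  have hyx' := sq_mulVec_le (gram y x) (fun p => ξ (.inr p.1, .inl p.2))
  have hyy := sq_mulVec_le (gram y y) (fun p => ξ (.inr p.1, .inr p.2))
  have sq : ∀ {a s : ℝ}, 0 ≤ a → 0 ≤ s → a ≤ max ‖gram x x‖ ‖gram y y‖ →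
      a ^ 2 * s ≤ max ‖gram x x‖ ‖gram y y‖ ^ 2 * s := by
    intro a s ha hs h
    gcongr
  replace hxx := hxx.trans (sq (norm_nonneg _) (by positivity) (le_max_left _ _))
  replace hyy := hyy.trans (sq (norm_nonneg _) (by positivity) (le_max_right _ _))
  replace hxy' := hxy'.trans (sq (norm_nonneg _) (by positivity) hxy)
  replace hyx' := hyx'.trans (sq (norm_nonneg _) (by positivity) hyx)
  simp only [Fintype.sum_prod_type, gram, of_apply] at hxx hxy' hyx' hyy
  simp only [Fintype.sum_prod_type, Fintype.sum_sum_type, gram, of_apply, fromBlocks_apply₁₁,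
    fromBlocks_apply₁₂, fromBlocks_apply₂₁, fromBlocks_apply₂₂, Matrix.zero_apply,
    inner_zero_left, inner_zero_right, zero_mul, Finset.sum_const_zero, add_zero, zero_add,
    Finset.sum_add_distrib]
  linarith

end Gram

end OperatorSpaceAux

/-! ### Operator spaces -/

section Definitions

open Matrix
open scoped Matrix.Norms.L2Operator Kronecker

universe u v

/-- The product `α x β` of a matrix `x` over a complex vector space with scalar matrices. -/
def sandwich {E : Type*} [AddCommGroup E] [Module ℂ E] {m n : ℕ} (α : Matrix (Fin m) (Fin n) ℂ)
    (x : Matrix (Fin n) (Fin n) E) (β : Matrix (Fin n) (Fin m) ℂ) : Matrix (Fin m) (Fin m) E :=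
  Matrix.of fun i j => ∑ k, ∑ l, (α i k * β l j) • x k l

/-- An (abstract) operator space structure on a complex normed space `E`: a norm on each
`Mₙ(E)`, equal to the given one for `n = 1`, satisfying Ruan's axioms
`‖x ⊕ y‖ ≤ max ‖x‖ ‖y‖` and `‖α x β‖ ≤ ‖α‖ ‖x‖ ‖β‖` for scalar matrices `α`, `β`
(with their operator norm).  Definiteness, and equality in the first axiom, follow. -/
class OperatorSpace (E : Type*) [NormedAddCommGroup E] [NormedSpace ℂ E] where
  matNorm (n : ℕ) : Seminorm ℂ (Matrix (Fin n) (Fin n) E)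
  matNorm_one (x : E) : matNorm 1 (Matrix.of fun _ _ => x) = ‖x‖
  matNorm_directSum_le {m n : ℕ} (x : Matrix (Fin m) (Fin m) E) (y : Matrix (Fin n) (Fin n) E) :
    matNorm (m + n) (Matrix.reindex finSumFinEquiv finSumFinEquiv (Matrix.fromBlocks x 0 0 y)) ≤
      max (matNorm m x) (matNorm n y)
  matNorm_sandwich_le {m n : ℕ} (α : Matrix (Fin m) (Fin n) ℂ) (x : Matrix (Fin n) (Fin n) E)
    (β : Matrix (Fin n) (Fin m) ℂ) :
    matNorm m (sandwich α x β) ≤ ‖α‖ * matNorm n x * ‖β‖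

open OperatorSpace (matNorm)

/-- The completely bounded norm of a linear map `u : E → F`: the least `C` such that
`‖(u (x i j))‖ ≤ C ‖(x i j)‖` for all matrices over `E` of all sizes; `∞` if there is none. -/
def cbNorm {E F : Type*} [NormedAddCommGroup E] [NormedSpace ℂ E] [OperatorSpace E]
    [NormedAddCommGroup F] [NormedSpace ℂ F] [OperatorSpace F] (u : E →ₗ[ℂ] F) : ℝ≥0∞ :=
  ⨅ (C : ℝ≥0) (_ : ∀ (n : ℕ) (x : Matrix (Fin n) (Fin n) E),
    matNorm n (x.map u) ≤ C * matNorm n x), (C : ℝ≥0∞)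

/-- The identification `M_n(M_p) = M_{np}`. -/
def flatten {n p : ℕ} (x : Matrix (Fin n) (Fin n) (Matrix (Fin p) (Fin p) ℂ)) :
    Matrix (Fin n × Fin p) (Fin n × Fin p) ℂ :=
  Matrix.of fun a b => x a.1 b.1 a.2 b.2

/-- The operator space `M_p` of `p × p` scalar matrices, with `M_n(M_p) = M_{np}`. -/
instance instOperatorSpaceMatrix (p : ℕ) : OperatorSpace (Matrix (Fin p) (Fin p) ℂ) where
  matNorm n := Seminorm.of (fun x => ‖flatten x‖)
    (fun x y => norm_add_le (flatten x) (flatten y))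
    (fun c x => norm_smul c (flatten x))
  matNorm_one x :=
    OperatorSpaceAux.norm_submatrix x (Equiv.uniqueProd (Fin p) (Fin 1))
      (Equiv.uniqueProd (Fin p) (Fin 1))
  matNorm_directSum_le {m n} x y := by
    change ‖flatten _‖ ≤ max ‖flatten x‖ ‖flatten y‖
    refine le_trans (le_of_eq ?_) (OperatorSpaceAux.norm_fromBlocks_le _ _)
    let e : Fin (m + n) × Fin p ≃ (Fin m × Fin p) ⊕ (Fin n × Fin p) :=
      (finSumFinEquiv.symm.prodCongr (Equiv.refl _)).trans (Equiv.sumProdDistrib _ _ _)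
    rw [← OperatorSpaceAux.norm_submatrix (fromBlocks _ 0 0 _) e e]
    congr 1
    ext ⟨i, k⟩ ⟨j, l⟩
    obtain ⟨i, rfl⟩ := finSumFinEquiv.surjective i
    obtain ⟨j, rfl⟩ := finSumFinEquiv.surjective j
    rcases i with i | i <;> rcases j with j | j <;> simp [e, flatten]
  matNorm_sandwich_le {m n} α x β := by
    change ‖flatten _‖ ≤ ‖α‖ * ‖flatten x‖ * ‖β‖
    have h : flatten (sandwich α x β) =
        (α ⊗ₖ (1 : Matrix (Fin p) (Fin p) ℂ)) * flatten x *
          (β ⊗ₖ (1 : Matrix (Fin p) (Fin p) ℂ)) := by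
      ext ⟨i, k⟩ ⟨j, l⟩
      simp only [flatten, sandwich, of_apply, mul_apply, Fintype.sum_prod_type,
        kroneckerMap_apply, Matrix.one_apply, Matrix.sum_apply, Matrix.smul_apply, smul_eq_mul,
        mul_ite, ite_mul, mul_one, mul_zero, zero_mul, Finset.sum_ite_eq, Finset.sum_ite_eq',
        Finset.mem_univ, if_true, Finset.sum_mul]
      rw [Finset.sum_comm]
      refine Finset.sum_congr rfl fun a _ => Finset.sum_congr rfl fun b _ => ?_
      ring
    have h1 : ∀ {a b : ℕ} (γ : Matrix (Fin a) (Fin b) ℂ),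
        ‖γ ⊗ₖ (1 : Matrix (Fin p) (Fin p) ℂ)‖ ≤ ‖γ‖ := fun γ =>
      (OperatorSpaceAux.norm_kronecker_le _ _).trans
        (mul_le_of_le_one_right (norm_nonneg _) OperatorSpaceAux.norm_one_le)
    rw [h]
    refine (l2_opNorm_mul _ _).trans ?_
    gcongr
    · refine (l2_opNorm_mul _ _).trans ?_
      gcongr
      exact h1 α
    · exact h1 β

/-- Pisier's operator Hilbert space `OH(I)`: the Hilbert space `ℓ²(I)` with the matrix norms
`‖∑ s, a s ⊗ e s‖ = ‖∑ s, a s ⊗ conj (a s)‖ ^ (1/2)`. -/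
abbrev OH (I : Type*) : Type _ := ℓ²(I, ℂ)

instance instOperatorSpaceOH (I : Type*) : OperatorSpace (OH I) where
  matNorm n := Seminorm.of (fun x => √‖OperatorSpaceAux.gram x x‖)
    OperatorSpaceAux.sqrt_norm_gram_add_le OperatorSpaceAux.sqrt_norm_gram_smul
  matNorm_one x := by
    change √‖OperatorSpaceAux.gram _ _‖ = ‖x‖
    have h : OperatorSpaceAux.gram (Matrix.of fun (_ _ : Fin 1) => x)
        (Matrix.of fun (_ _ : Fin 1) => x) = diagonal fun _ => inner ℂ x x := by
      ext i j
      rw [Subsingleton.elim i j, diagonal_apply_eq]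
      rfl
    rw [h, l2_opNorm_diagonal, pi_norm_const, inner_self_eq_norm_sq_to_K]
    simp
  matNorm_directSum_le {m n} x y := by
    change √‖OperatorSpaceAux.gram _ _‖ ≤
      max (√‖OperatorSpaceAux.gram x x‖) (√‖OperatorSpaceAux.gram y y‖)
    rw [Matrix.reindex_apply, OperatorSpaceAux.norm_gram_submatrix,
      ← (Real.sqrt_monotone).map_max]
    exact Real.sqrt_le_sqrt (OperatorSpaceAux.norm_gram_fromBlocks_le x y)
  matNorm_sandwich_le {m n} α x β := by
    change √‖OperatorSpaceAux.gram _ _‖ ≤ ‖α‖ * √‖OperatorSpaceAux.gram x x‖ * ‖β‖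
    have h : OperatorSpaceAux.gram (sandwich α x β) (sandwich α x β) =
        (α ⊗ₖ α.map conj) * OperatorSpaceAux.gram x x * (β ⊗ₖ β.map conj) := by
      ext ⟨i, k⟩ ⟨j, l⟩
      simp only [OperatorSpaceAux.gram, sandwich, of_apply, mul_apply, Fintype.sum_prod_type,
        kroneckerMap_apply, map_apply, sum_inner, inner_sum, inner_smul_left, inner_smul_right,
        map_mul, Finset.sum_mul, Finset.mul_sum]
      simp only [← Fintype.sum_prod_type']
      refine Fintype.sum_equiv ⟨fun z => (z.2.1, z.2.2.2, z.1, z.2.2.1),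
        fun z => (z.2.2.1, z.1, z.2.2.2, z.2.1), fun _ => rfl, fun _ => rfl⟩ _ _ fun z => ?_
      simp only [Equiv.coe_fn_mk]
      ring
    have h1 : ∀ {a b : ℕ} (γ : Matrix (Fin a) (Fin b) ℂ), ‖γ ⊗ₖ γ.map conj‖ ≤ ‖γ‖ ^ 2 := fun γ => by
      refine (OperatorSpaceAux.norm_kronecker_le _ _).trans ?_
      rw [OperatorSpaceAux.norm_map_conj, sq]
    rw [Real.sqrt_le_left (by positivity), h]
    calc _ ≤ ‖α ⊗ₖ α.map conj‖ * ‖OperatorSpaceAux.gram x x‖ * ‖β ⊗ₖ β.map conj‖ :=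
          (l2_opNorm_mul _ _).trans (mul_le_mul_of_nonneg_right (l2_opNorm_mul _ _) (norm_nonneg _))
      _ ≤ ‖α‖ ^ 2 * ‖OperatorSpaceAux.gram x x‖ * ‖β‖ ^ 2 := by
          gcongr
          · exact h1 α
          · exact h1 β
      _ = _ := by rw [mul_pow, mul_pow, Real.sq_sqrt (norm_nonneg _)]

/-- The complex conjugate `Ē` of a complex vector space `E`. -/
def Conj (E : Type*) : Type _ := E

namespace Conj

variable {E : Type*} [NormedAddCommGroup E] [NormedSpace ℂ E]

/-- The canonical antilinear map `x ↦ x̄` from `E` to its conjugate. -/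
def mk (x : E) : Conj E := x

instance : NormedAddCommGroup (Conj E) := inferInstanceAs (NormedAddCommGroup E)

instance : Module ℂ (Conj E) := Module.compHom E (starRingEnd ℂ)

lemma smul_mk (c : ℂ) (x : E) : c • mk x = mk (conj c • x) := rfl

instance : NormedSpace ℂ (Conj E) where
  norm_smul_le c x := by
    refine (norm_smul_le (conj c) (show E from x)).trans ?_
    rw [RCLike.norm_conj]
    exact le_rfl

/-- The conjugate operator space: `‖(x̄ i j)‖ = ‖(x i j)‖`. -/
instance [OperatorSpace E] : OperatorSpace (Conj E) where
  matNorm n := Seminorm.of (fun x : Matrix (Fin n) (Fin n) (Conj E) =>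
      matNorm n (show Matrix (Fin n) (Fin n) E from x))
    (fun x y => map_add_le_add (matNorm (E := E) n) x y)
    (fun c x => by
      refine (map_smul_eq_mul (matNorm (E := E) n) (conj c) x).trans ?_
      rw [RCLike.norm_conj]
      rfl)
  matNorm_one x := OperatorSpace.matNorm_one (E := E) x
  matNorm_directSum_le x y := OperatorSpace.matNorm_directSum_le (E := E) x y
  matNorm_sandwich_le α x β := by
    have h := OperatorSpace.matNorm_sandwich_le (E := E) (α.map conj) x (β.map conj)
    rw [OperatorSpaceAux.norm_map_conj, OperatorSpaceAux.norm_map_conj] at h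
    refine le_trans (le_of_eq ?_) h
    refine congrArg (matNorm (E := E) _) ?_
    ext i j
    simp only [sandwich, of_apply, map_apply, ← map_mul]
    rfl

end Conj

/-- The minimal tensor norm on `E ⊗ F`: the supremum of `‖(φ ⊗ ψ) t‖` over all complete
contractions `φ : E → M_p`, `ψ : F → M_q`, where `M_p ⊗ M_q = M_{pq}`. -/
def minNorm {E F : Type*} [NormedAddCommGroup E] [NormedSpace ℂ E] [OperatorSpace E]
    [NormedAddCommGroup F] [NormedSpace ℂ F] [OperatorSpace F] (t : E ⊗[ℂ] F) : ℝ≥0∞ :=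
  ⨆ (p : ℕ) (q : ℕ) (φ : E →ₗ[ℂ] Matrix (Fin p) (Fin p) ℂ)
    (ψ : F →ₗ[ℂ] Matrix (Fin q) (Fin q) ℂ) (_ : cbNorm φ ≤ 1) (_ : cbNorm ψ ≤ 1),
    ‖TensorProduct.lift ((Matrix.kroneckerBilinear (l := Fin p) (m := Fin p) (n := Fin q)
      (p := Fin q) (R := ℂ) (α := ℂ)).compl₁₂ φ ψ) t‖ₑ

/-- The `(2,oh)`-summing norm of `w : E → Y`, with values in `[0, ∞]`. -/
def pi2oh {E Y : Type*} [NormedAddCommGroup E] [NormedSpace ℂ E] [OperatorSpace E]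
    [NormedAddCommGroup Y] [NormedSpace ℂ Y] (w : E →ₗ[ℂ] Y) : ℝ≥0∞ :=
  ⨅ (C : ℝ≥0) (_ : ∀ (n : ℕ) (x : Fin n → E),
    ∑ i, ‖w (x i)‖ₑ ^ 2 ≤ (C : ℝ≥0∞) ^ 2 * minNorm (∑ i, x i ⊗ₜ[ℂ] Conj.mk (x i))), (C : ℝ≥0∞)

/-- `δ(T) = inf ‖v‖_cb π_{2,oh}(w)` over all factorizations `T = v w` through some `OH(I)`;
it is `∞` if there is no factorization with `‖v‖_cb` and `π_{2,oh}(w)` finite. -/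
def delta {E : Type u} {F : Type v} [NormedAddCommGroup E] [NormedSpace ℂ E] [OperatorSpace E]
    [NormedAddCommGroup F] [NormedSpace ℂ F] [OperatorSpace F] (T : E →ₗ[ℂ] F) : ℝ≥0∞ :=
  ⨅ (I : Type u) (w : E →ₗ[ℂ] OH I) (v : OH I →ₗ[ℂ] F) (_ : v ∘ₗ w = T), cbNorm v * pi2oh w

/-- `E` has the `(K, k(n))`-OUAP. -/
def HasOUAP (E : Type*) [NormedAddCommGroup E] [NormedSpace ℂ E] [OperatorSpace E]
    (K : ℝ) (k : ℕ → ℝ≥0) : Prop :=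
  1 ≤ K ∧ ∀ (n : ℕ) (M : Submodule ℂ E), FiniteDimensional ℂ M → Module.finrank ℂ M = n →
    ∃ T : E →ₗ[ℂ] E, FiniteDimensional ℂ (LinearMap.range T) ∧ cbNorm T ≤ ENNReal.ofReal K ∧
      (Module.finrank ℂ (LinearMap.range T) : ℝ≥0) ≤ k n ∧ ∀ x ∈ M, T x = x

/-- `E` has the `(K, k(n))`-`δ`-OUAP. -/
def HasDeltaOUAP (E : Type*) [NormedAddCommGroup E] [NormedSpace ℂ E] [OperatorSpace E]
    (K : ℝ) (k : ℕ → ℝ≥0) : Prop :=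
  1 ≤ K ∧ ∀ (n : ℕ) (M : Submodule ℂ E), FiniteDimensional ℂ M → Module.finrank ℂ M = n →
    ∃ T : E →ₗ[ℂ] E, FiniteDimensional ℂ (LinearMap.range T) ∧ cbNorm T ≤ ENNReal.ofReal K ∧
      delta T ≤ (k n : ℝ≥0∞) ∧ ∀ x ∈ M, T x = x

end Definitions

end

/-! ### Gram determinants and finite rank approximation of powers of Hilbert-Schmidt operators. -/

section HilbertSpace

open Matrix
open scoped ComplexOrder InnerProductSpace

/-! Let `T = v w` factor through `OH(I)`, with `a` bounding `‖v‖_cb` and `b` bounding `π_{2,oh}(w)`.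
Going round the other way, `w v` is an operator on a Hilbert space, and it is Hilbert-Schmidt with
norm at most `a b` (`IsPi2ohBound.sum_comp_le`). Its singular values therefore decay, and those of
its `m`-th power decay much faster: `(w v)^m`, cut down to the closed range of `w`, is within `(a b
/ √N)^m` of an operator `B` of rank less than `N` (`exists_finrank_range_lt_approx_pow`). The
multiplicative behaviour of singular values is replaced by an estimate of Gram determinants
(`norm_det_gram_pow_le`).

Operator norm estimates on `OH` are automatically cb estimates, because `OH` is homogeneous
(`isCBBound_of_norm_le`), and `‖w‖_cb ≤ b` (`IsPi2ohBound.isCBBound`). Hence `S = v B w` has rank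
less than `N`, and `D = T^(m+1) - S = v ((w v)^m - B) w` has cb norm at most `a b (a b / √N)^m`,
which is at most `1/m` once `N ≥ m^(2/m) (a b)^(2+2/m)`.

On `M` the map `T^(m+1)` is the identity, so `1 - D` agrees with `S` there. Thus `(1 - D)⁻¹ S` fixes
`M`, has rank at most that of `S`, and its cb norm is at most `(1 - 1/m)⁻¹ (1/m + K^(m+1))`. -/

/-- The arithmetic-geometric mean inequality for the eigenvalues of a positive semidefinite
matrix. -/
lemma Matrix.PosSemidef.norm_det_le {n : Type*} [Fintype n] [DecidableEq n] {A : Matrix n n ℂ}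
    (hA : A.PosSemidef) : ‖A.det‖ ≤ (A.trace.re / Fintype.card n) ^ Fintype.card n := by
  have hpos := hA.eigenvalues_nonneg
  rcases isEmpty_or_nonempty n with hn | hn
  · simp
  have hc : (Fintype.card n : ℝ) ≠ 0 := by exact_mod_cast Fintype.card_ne_zero
  rw [hA.1.det_eq_prod_eigenvalues, hA.1.trace_eq_sum_eigenvalues]
  have h := Real.geom_mean_le_arith_mean Finset.univ (fun _ => (1 : ℝ)) hA.1.eigenvalues
    (fun _ _ => zero_le_one) (by simp [Fintype.card_pos]) (fun i _ => hpos i)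
  simp only [Real.rpow_one, Finset.sum_const, Finset.card_univ, nsmul_eq_mul, mul_one,
    one_mul] at h
  have h0 : 0 ≤ ∏ i, hA.1.eigenvalues i := Finset.prod_nonneg fun i _ => hpos i
  have h1 : ‖∏ i, ((hA.1.eigenvalues i : ℝ) : ℂ)‖ = ∏ i, hA.1.eigenvalues i := by
    rw [← Complex.ofReal_prod, Complex.norm_real, Real.norm_of_nonneg h0]
  have h2 : (∑ i, ((hA.1.eigenvalues i : ℝ) : ℂ)).re = ∑ i, hA.1.eigenvalues i := by
    rw [← Complex.ofReal_sum, Complex.ofReal_re]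
  refine (h1.trans_le ?_).trans_eq (congrArg (fun t => (t / _) ^ _) h2.symm)
  have h3 := pow_le_pow_left₀ (by positivity) h (Fintype.card n)
  rwa [← Real.rpow_natCast, ← Real.rpow_mul h0, inv_mul_cancel₀ hc, Real.rpow_one] at h3

variable {H H' : Type*} [NormedAddCommGroup H] [InnerProductSpace ℂ H]
  [NormedAddCommGroup H'] [InnerProductSpace ℂ H']

/-- In an orthonormal basis `b` of the span of independent `x`, with coordinate matrix `m`, the Gram
matrices of `x` and `A x` are `mᴴ m` and `mᴴ G m`, where `G` is the Gram matrix of `A b`. The trace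
of `G` is at most `c`, so the arithmetic-geometric mean inequality bounds `det G`. -/
lemma norm_det_gram_map_le {N : ℕ} (A : H →ₗ[ℂ] H') {c : ℝ}
    (hA : ∀ f : Fin N → H, Orthonormal ℂ f → ∑ i, ‖A (f i)‖ ^ 2 ≤ c) (x : Fin N → H) :
    ‖(gram ℂ (A ∘ x)).det‖ ≤ (c / N) ^ N * ‖(gram ℂ x).det‖ := by
  by_cases hx : (gram ℂ x).det = 0
  · have : (gram ℂ (A ∘ x)).det = 0 := by
      by_contra h
      rw [← ne_eq, det_gram_ne_zero_iff_linearIndependent] at h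
      exact det_gram_ne_zero_iff_linearIndependent.mpr (LinearIndependent.of_comp A h) hx
    simp [hx, this]
  have hli := det_gram_ne_zero_iff_linearIndependent.mp hx
  let W := Submodule.span ℂ (Set.range x)
  have hW : Module.finrank ℂ W = N := by
    rw [finrank_span_eq_card hli, Fintype.card_fin]
  have : FiniteDimensional ℂ W := FiniteDimensional.span_of_finite ℂ (Set.finite_range x)
  let b : OrthonormalBasis (Fin N) ℂ W := (stdOrthonormalBasis ℂ W).reindex (finCongr hW)
  let y : Fin N → W := fun i => ⟨x i, Submodule.subset_span ⟨i, rfl⟩⟩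
  let m : Matrix (Fin N) (Fin N) ℂ := of fun i j => b.repr (y j) i
  have hb : Orthonormal ℂ (fun i => (b i : H)) :=
    b.orthonormal.comp_linearIsometry W.subtypeₗᵢ
  have h1 : gram ℂ x = mᴴ * m := gram_eq_conjTranspose_mul b y
  have h2 : gram ℂ (A ∘ x) = mᴴ * gram ℂ (fun i => A (b i)) * m := by
    have hy : ∀ j, A (x j) = ∑ i, m i j • A (b i) := fun j => by
      have : x j = ∑ i, m i j • (b i : H) := by
        have := congrArg (Subtype.val) (b.sum_repr (y j))
        rw [Submodule.coe_sum] at this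
        exact this.symm
      rw [this, map_sum]
      simp only [map_smul]
    ext i j
    simp only [gram_apply, Function.comp, hy, sum_inner, inner_sum, inner_smul_left,
      inner_smul_right, mul_apply, conjTranspose_apply, Finset.sum_mul, Finset.mul_sum]
    refine Finset.sum_congr rfl fun k _ => Finset.sum_congr rfl fun l _ => ?_
    rw [← starRingEnd_apply]
    ring
  have h3 : ‖(gram ℂ (fun i => A (b i))).det‖ ≤ (c / N) ^ N := by
    refine ((posSemidef_gram ℂ _).norm_det_le).trans ?_
    have e : (gram ℂ (fun i => A (b i))).trace.re = ∑ i, ‖A (b i)‖ ^ 2 := by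
      simp only [trace, diag, gram_apply, Complex.re_sum]
      refine Finset.sum_congr rfl fun i _ => ?_
      rw [inner_self_eq_norm_sq_to_K]
      norm_cast
    rw [e, Fintype.card_fin]
    gcongr
    exact hA _ hb
  rw [h1, h2, det_mul, det_mul, det_mul, norm_mul, norm_mul, norm_mul]
  calc _ = ‖(gram ℂ (fun i => A (b i))).det‖ * (‖mᴴ.det‖ * ‖m.det‖) := by ring
    _ ≤ _ := by gcongr

/-- The one-step bound can be iterated, although `A` moves the span of `x`, because `hA` covers
every orthonormal `N`-tuple. This takes the place of Weyl's inequality for products of singular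
values. -/
lemma norm_det_gram_pow_le {N : ℕ} (A : H →ₗ[ℂ] H) {c : ℝ} (hc : 0 ≤ c)
    (hA : ∀ f : Fin N → H, Orthonormal ℂ f → ∑ i, ‖A (f i)‖ ^ 2 ≤ c) (m : ℕ) (x : Fin N → H) :
    ‖(gram ℂ ((A ^ m) ∘ x)).det‖ ≤ ((c / N) ^ N) ^ m * ‖(gram ℂ x).det‖ := by
  induction m with
  | zero => simp [Function.comp_def]
  | succ m ih =>
    have e : (A ^ (m + 1)) ∘ x = A ∘ ((A ^ m) ∘ x) := by
      rw [pow_succ']; rfl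
    rw [e]
    refine (norm_det_gram_map_le A hA _).trans ?_
    rw [pow_succ' ((c / N) ^ N), mul_assoc]
    gcongr

/-- A finite rank operator that is not bounded below by `s` on any `N` dimensional
subspace spanned by singular vectors is within `s` of an operator of rank less than `N`. -/
lemma exists_finrank_range_lt_approx [CompleteSpace H] [CompleteSpace H'] (C : H →L[ℂ] H')
    [FiniteDimensional ℂ (LinearMap.range (C : H →ₗ[ℂ] H'))] {s : ℝ} (hs : 0 ≤ s) {N : ℕ}
    (h : ∀ u : Fin N → H, Orthonormal ℂ u → ∀ μ : Fin N → ℝ,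
      (∀ i j, ⟪C (u i), C (u j)⟫_ℂ = if i = j then (μ i : ℂ) else 0) → ∃ i, μ i ≤ s ^ 2) :
    ∃ B : H →ₗ[ℂ] H', Module.Finite ℂ (LinearMap.range B) ∧
      Module.finrank ℂ (LinearMap.range B) < N ∧ ∀ x, ‖C x - B x‖ ≤ s * ‖x‖ := by
  classical
  let Z := LinearMap.ker (C : H →ₗ[ℂ] H')
  have hZ : IsClosed (Z : Set H) := C.isClosed_ker
  have : CompleteSpace Z := hZ.completeSpace_coe
  let L : Zᗮ →L[ℂ] H' := C ∘L Zᗮ.subtypeL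
  have hLinj : Function.Injective L := by
    rw [injective_iff_map_eq_zero]
    intro x hx
    have h1 : (x : H) ∈ Z := hx
    have h2 : (x : H) = 0 := by
      have := Submodule.inner_right_of_mem_orthogonal h1 x.2
      exact inner_self_eq_zero.mp this
    exact Subtype.ext h2
  -- `C` is injective on the complement of its kernel and has finite rank, so singular vectors come
  -- from the finite-dimensional spectral theorem for `L* L`.
  have : FiniteDimensional ℂ Zᗮ := by
    let L' : Zᗮ →ₗ[ℂ] LinearMap.range (C : H →ₗ[ℂ] H') :=
      (L : Zᗮ →ₗ[ℂ] H').codRestrict _ (fun x => ⟨x, rfl⟩)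
    refine Module.Finite.of_injective L' ?_
    intro x y hxy
    exact hLinj (congrArg Subtype.val hxy)
  let S : Zᗮ →ₗ[ℂ] Zᗮ := ((ContinuousLinearMap.adjoint L) ∘L L : Zᗮ →L[ℂ] Zᗮ)
  have hS : S.IsSymmetric := fun x y => by
    simp [S, ContinuousLinearMap.adjoint_inner_left, ContinuousLinearMap.adjoint_inner_right]
  let b := hS.eigenvectorBasis rfl
  let μ := hS.eigenvalues rfl
  have hin : ∀ i j, ⟪C (b i), C (b j)⟫_ℂ = if i = j then (μ i : ℂ) else 0 := fun i j => by
    have h1 : ⟪C (b i), C (b j)⟫_ℂ = ⟪b i, S (b j)⟫_ℂ := by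
      simp [S, L, ContinuousLinearMap.adjoint_inner_right]
    rw [h1, hS.apply_eigenvectorBasis rfl j, inner_smul_right]
    rw [orthonormal_iff_ite.mp b.orthonormal]
    split_ifs with hij
    · subst hij; simp [μ]
    · simp
  have hb : Orthonormal ℂ (fun i => (b i : H)) :=
    b.orthonormal.comp_linearIsometry Zᗮ.subtypeₗᵢ
  -- `B` truncates the singular value decomposition to singular values above `s`; the hypothesis
  -- excludes having `N` of them.
  let J := Finset.univ.filter fun i => s ^ 2 < μ i
  let B : H →ₗ[ℂ] H' := ∑ i ∈ J, (innerₛₗ ℂ (b i : H)).smulRight (C (b i))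
  have hB : ∀ x, B x = ∑ i ∈ J, ⟪(b i : H), x⟫_ℂ • C (b i) := fun x => by
    simp [B, LinearMap.sum_apply]
  have hrange : LinearMap.range B ≤ Submodule.span ℂ (J.image fun i => C (b i)) := by
    rintro _ ⟨x, rfl⟩
    rw [hB]
    exact Submodule.sum_mem _ fun i hi => Submodule.smul_mem _ _
      (Submodule.subset_span (by simpa using ⟨i, hi, rfl⟩))
  have hJ : J.card < N := by
    by_contra hJ
    push Not at hJ
    obtain ⟨J', hJ', hcard⟩ := Finset.exists_subset_card_eq hJ
    let e : Fin N ≃ J' := (finCongr hcard.symm).trans J'.equivFin.symm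
    have hbe : Orthonormal ℂ (fun i => (b (e i) : H)) :=
      hb.comp (fun i : Fin N => (e i).1) (Subtype.val_injective.comp e.injective)
    obtain ⟨i, hi⟩ := h _ hbe
      (fun i => μ (e i)) (fun i j => by
        rw [hin]; simp [Subtype.ext_iff.symm, e.injective.eq_iff])
    have := (Finset.mem_filter.mp (hJ' (e i).2)).2
    linarith
  refine ⟨B, ?_, ?_, fun x => ?_⟩
  · exact Submodule.finiteDimensional_of_le hrange
  · refine (Submodule.finrank_mono hrange).trans_lt ?_
    exact ((finrank_span_finset_le_card _).trans Finset.card_image_le).trans_lt hJ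
  have hC : C x = ∑ i, ⟪(b i : H), x⟫_ℂ • C (b i) := by
    have h1 : C x = C (Zᗮ.starProjection x) := by
      have h2 : x - Zᗮ.starProjection x ∈ Z := by
        have := Submodule.sub_starProjection_mem_orthogonal (K := Zᗮ) x
        rwa [Submodule.orthogonal_orthogonal] at this
      have h3 : C (x - Zᗮ.starProjection x) = 0 := h2
      rwa [map_sub, sub_eq_zero] at h3
    have h4 := b.sum_repr' (Zᗮ.orthogonalProjectionOnto x)
    have h5 := congrArg (fun z : Zᗮ => C z) h4
    simp only [Submodule.coe_sum, map_sum, Submodule.coe_smul, map_smul] at h5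
    rw [h1]
    refine h5.symm.trans ?_
    refine Finset.sum_congr rfl fun i _ => ?_
    congr 1
    exact (Submodule.inner_orthogonalProjectionOnto_eq_of_mem_left (b i) x)
  have hdiff : C x - B x = ∑ i ∈ Jᶜ, ⟪(b i : H), x⟫_ℂ • C (b i) := by
    rw [hC, hB, ← Finset.sum_add_sum_compl J, add_sub_cancel_left]
  have hnorm : ∀ z : H', ((‖z‖ : ℝ) : ℂ) ^ 2 = ⟪z, z⟫_ℂ := fun z =>
    (inner_self_eq_norm_sq_to_K z).symm
  have hsq : ‖C x - B x‖ ^ 2 = ∑ i ∈ Jᶜ, ‖⟪(b i : H), x⟫_ℂ‖ ^ 2 * μ i := by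
    have : ((‖C x - B x‖ ^ 2 : ℝ) : ℂ) = ((∑ i ∈ Jᶜ, ‖⟪(b i : H), x⟫_ℂ‖ ^ 2 * μ i : ℝ) : ℂ) := by
      push_cast
      rw [hnorm, hdiff]
      simp only [sum_inner, inner_sum, inner_smul_left, inner_smul_right, hin]
      refine Finset.sum_congr rfl fun i hi => ?_
      rw [Finset.sum_eq_single i]
      · rw [if_pos rfl, ← mul_assoc, Complex.mul_conj']
      · intro j _ hj
        simp [hj]
      · exact fun h => absurd hi h
    exact_mod_cast this
  refine (sq_le_sq₀ (norm_nonneg _) (by positivity)).mp ?_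
  rw [hsq, mul_pow]
  calc _ ≤ ∑ i ∈ Jᶜ, s ^ 2 * ‖⟪(b i : H), x⟫_ℂ‖ ^ 2 := by
        refine Finset.sum_le_sum fun i hi => ?_
        have : μ i ≤ s ^ 2 := by simpa [J] using hi
        rw [mul_comm]
        gcongr
    _ ≤ s ^ 2 * ‖x‖ ^ 2 := by
        rw [← Finset.mul_sum]
        gcongr
        exact hb.sum_inner_products_le x

/-- If the Hilbert-Schmidt norm of `A` is at most `√c`, then `A ^ m` is within `(c / N) ^ (m / 2)`
of an operator of rank less than `N`. -/
lemma exists_finrank_range_lt_approx_pow [CompleteSpace H] (A : H →L[ℂ] H)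
    [FiniteDimensional ℂ (LinearMap.range (A : H →ₗ[ℂ] H))] {c : ℝ} (hc : 0 ≤ c) {N : ℕ}
    (hN : 0 < N) (hA : ∀ f : Fin N → H, Orthonormal ℂ f → ∑ i, ‖A (f i)‖ ^ 2 ≤ c) {m : ℕ}
    (hm : 0 < m) :
    ∃ B : H →ₗ[ℂ] H, Module.Finite ℂ (LinearMap.range B) ∧
      Module.finrank ℂ (LinearMap.range B) < N ∧
      ∀ x, ‖(A ^ m) x - B x‖ ≤ √(c / N) ^ m * ‖x‖ := by
  have : FiniteDimensional ℂ (LinearMap.range ((A ^ m : H →L[ℂ] H) : H →ₗ[ℂ] H)) := by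
    refine Submodule.finiteDimensional_of_le (S₂ := LinearMap.range (A : H →ₗ[ℂ] H)) ?_
    rintro _ ⟨x, rfl⟩
    obtain ⟨k, rfl⟩ := Nat.exists_eq_succ_of_ne_zero hm.ne'
    exact ⟨(A ^ k) x, by rw [Nat.succ_eq_add_one, pow_succ']; rfl⟩
  refine exists_finrank_range_lt_approx (A ^ m) (by positivity) fun u hu μ hμ => ?_
  -- If every `μ i` exceeds `(c/N)^m`, the Gram determinant `∏ μ i` of `A^m u` exceeds
  -- `((c/N)^N)^m`, contradicting the determinant bound for orthonormal `u`.
  by_contra! hcon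
  have h1 := norm_det_gram_pow_le (A : H →ₗ[ℂ] H) hc hA m u
  have h2 : gram ℂ (((A : H →ₗ[ℂ] H) ^ m) ∘ u) = diagonal fun i => (μ i : ℂ) := by
    ext i j
    rw [diagonal_apply, gram_apply, ← hμ, ← ContinuousLinearMap.toLinearMap_pow]
    rfl
  rw [h2, gram_eq_one_iff_orthonormal.mpr hu, det_one, norm_one, mul_one, det_diagonal,
    norm_prod] at h1
  have h3 : ∀ i, ((c / N) ^ m) < ‖(μ i : ℂ)‖ := fun i => by
    have h4 := hcon i
    rw [← pow_mul, mul_comm, pow_mul, Real.sq_sqrt (by positivity)] at h4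
    rw [Complex.norm_real]
    exact h4.trans_le (le_abs_self _)
  have h5 : ∏ _i : Fin N, (c / N) ^ m < ∏ i, ‖(μ i : ℂ)‖ := by
    -- Strict comparison of products needs positive factors on the smaller side, hence the separate
    -- case `c = 0`.
    rcases hc.eq_or_lt with h0 | h0
    · subst h0
      simp only [zero_div, zero_pow hm.ne'] at h3 ⊢
      rw [Finset.prod_const, Finset.card_univ, Fintype.card_fin, zero_pow hN.ne']
      exact Finset.prod_pos fun i _ => h3 i
    · exact Finset.prod_lt_prod_of_nonempty (fun i _ => by positivity) (fun i _ => h3 i)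
        ⟨⟨0, hN⟩, Finset.mem_univ _⟩
  rw [Finset.prod_const, Finset.card_univ, Fintype.card_fin, ← pow_mul, mul_comm, pow_mul] at h5
  linarith

end HilbertSpace

/-! ### Computing `OH` matrix norms through Hilbert-Schmidt sums. -/

namespace OperatorSpaceAux

open Matrix
open scoped Matrix.Norms.L2Operator Kronecker InnerProductSpace

set_option linter.unusedSectionVars false

section Comb

variable {H H' : Type*} [NormedAddCommGroup H] [InnerProductSpace ℂ H]
  [NormedAddCommGroup H'] [InnerProductSpace ℂ H']
variable {ι κ ρ τ : Type*} [Fintype ι] [Fintype κ] [Fintype ρ] [Fintype τ]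
variable [DecidableEq ι] [DecidableEq κ] [DecidableEq ρ]

/-- Converse of `sum_comb_sq_le`: together they compute the `OH` norm from ordinary Hilbert space
norms of the entries of `Rᴴ x P`. Test vectors, read as matrices, factor as `R Sᴴ` and `P Qᴴ` with
balanced factors; the sesquilinear form becomes a sum of inner products, and Cauchy-Schwarz applies.
-/
lemma norm_gram_self_le_of_sum_comb_sq_le (x : Matrix ι ι H) {C : ℝ} (hC : 0 ≤ C)
    (h : ∀ R P : Matrix ι ι ℂ, ∑ t, ∑ r, ‖comb R P x t r‖ ^ 2 ≤
      C * (√(∑ i, ∑ j, ‖(R * Rᴴ) i j‖ ^ 2) * √(∑ i, ∑ j, ‖(P * Pᴴ) i j‖ ^ 2))) :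
    ‖gram x x‖ ≤ C := by
  refine norm_le_of_sesq_le _ hC fun η ξ => ?_
  obtain ⟨R, S, hη, hη'⟩ := exists_factor (Matrix.of fun i k => η (i, k))
  obtain ⟨P, Q, hξ, hξ'⟩ := exists_factor (Matrix.of fun i k => ξ (i, k))
  obtain ⟨hR, hS⟩ := factor_sum_sq hη hη'
  obtain ⟨hP, hQ⟩ := factor_sum_sq hξ hξ'
  have e1 : ∀ p : ι × ι, η p = (R * Sᴴ) p.1 p.2 := fun p => by rw [← hη]; rfl
  have e2 : ∀ p : ι × ι, ξ p = (P * Qᴴ) p.1 p.2 := fun p => by rw [← hξ]; rfl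
  have e3 : ∑ p, ‖η p‖ ^ 2 = ∑ i, ∑ k, ‖η (i, k)‖ ^ 2 := Fintype.sum_prod_type _
  have e4 : ∑ p, ‖ξ p‖ ^ 2 = ∑ i, ∑ k, ‖ξ (i, k)‖ ^ 2 := Fintype.sum_prod_type _
  have hX := h R P
  have hY := h S Q
  rw [hR, hP] at hX
  rw [hS, hQ] at hY
  simp only [of_apply] at hX hY
  rw [← e3, ← e4] at hX hY
  have e5 : ∑ p, ∑ q, conj (η p) * gram x x p q * ξ q =
      ∑ t, ∑ r, inner ℂ (comb S Q x t r) (comb R P x t r) := by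
    rw [← gram_sesq]
    simp only [e1, e2]
  rw [e5]
  set c := √(∑ p, ‖η p‖ ^ 2) * √(∑ p, ‖ξ p‖ ^ 2) with hc
  have hc0 : 0 ≤ c := by positivity
  calc ‖∑ t, ∑ r, inner ℂ (comb S Q x t r) (comb R P x t r)‖
      ≤ ∑ p : ι × ι, ‖comb S Q x p.1 p.2‖ * ‖comb R P x p.1 p.2‖ := by
        rw [← Fintype.sum_prod_type' (fun t r => inner ℂ (comb S Q x t r) (comb R P x t r))]
        exact (norm_sum_le _ _).trans (Finset.sum_le_sum fun p _ => norm_inner_le_norm _ _)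
    _ ≤ √(∑ p : ι × ι, ‖comb S Q x p.1 p.2‖ ^ 2) * √(∑ p : ι × ι, ‖comb R P x p.1 p.2‖ ^ 2) :=
        Real.sum_mul_le_sqrt_mul_sqrt _ _ _
    _ ≤ √(C * c) * √(C * c) := by
        rw [Fintype.sum_prod_type, Fintype.sum_prod_type]
        gcongr
    _ = C * c := Real.mul_self_sqrt (by positivity)

lemma comb_map (A : H →ₗ[ℂ] H') (R P : Matrix ι ρ ℂ) (x : Matrix ι ι H) (t r : ρ) :
    comb R P (x.map A) t r = A (comb R P x t r) := by
  simp [comb]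

/-- The homogeneity of the operator Hilbert space. -/
lemma norm_gram_map_le (A : H →ₗ[ℂ] H') {c : ℝ} (hA : ∀ x, ‖A x‖ ≤ c * ‖x‖)
    (x : Matrix ι ι H) : ‖gram (x.map A) (x.map A)‖ ≤ c ^ 2 * ‖gram x x‖ := by
  refine norm_gram_self_le_of_sum_comb_sq_le _ (by positivity) fun R P => ?_
  simp only [comb_map]
  calc _ ≤ ∑ t, ∑ r, c ^ 2 * ‖comb R P x t r‖ ^ 2 := by
        gcongr with t _ r
        rw [← mul_pow]
        exact pow_le_pow_left₀ (norm_nonneg _) (hA _) 2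
    _ = c ^ 2 * ∑ t, ∑ r, ‖comb R P x t r‖ ^ 2 := by simp only [Finset.mul_sum]
    _ ≤ _ := by
        rw [mul_assoc]
        gcongr
        exact sum_comb_sq_le x R P

/-- A family of scalar matrices, as a matrix of vectors. -/
def ofFamily (a : τ → Matrix ι ι ℂ) : Matrix ι ι (EuclideanSpace ℂ τ) :=
  Matrix.of fun k l => WithLp.toLp 2 fun s => a s k l

lemma gram_ofFamily (a : τ → Matrix ι ι ℂ) (b : τ → Matrix κ κ ℂ) :
    gram (ofFamily a) (ofFamily b) = ∑ s, a s ⊗ₖ (b s).map conj := by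
  ext p q
  simp [gram, ofFamily, Matrix.sum_apply, PiLp.inner_apply]

lemma sum_kronecker_sq (A : Matrix ι ι ℂ) (B : Matrix κ κ ℂ) :
    ∑ i, ∑ j, ‖(A ⊗ₖ B) i j‖ ^ 2 = (∑ i, ∑ j, ‖A i j‖ ^ 2) * ∑ i, ∑ j, ‖B i j‖ ^ 2 := by
  simp only [← Fintype.sum_prod_type', Finset.sum_mul_sum]
  exact Fintype.sum_equiv (Equiv.prodProdProdComm ι κ ι κ) _ _ fun z => by
    simp [kroneckerMap_apply, mul_pow]

lemma norm_gram_scalar_le (A : Matrix ι ι ℂ) : ‖gram A A‖ ≤ ‖A‖ ^ 2 := by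
  have : gram A A = A ⊗ₖ A.map conj := by
    ext p q
    simp [gram]
  rw [this, sq]
  exact (norm_kronecker_le _ _).trans_eq (by rw [norm_map_conj])

lemma sum_norm_sq_eq_of_coord (f : Matrix (ι × κ) (ι × κ) ℂ)
    (g : Matrix κ κ (EuclideanSpace ℂ (ι × ι)))
    (h : ∀ t' r' t r, f (t, t') (r, r') = (g t' r').ofLp (t, r)) :
    ∑ t', ∑ r', ‖g t' r'‖ ^ 2 = ∑ s, ∑ s', ‖f s s'‖ ^ 2 := by
  simp only [EuclideanSpace.norm_sq_eq, Fintype.sum_prod_type, h]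
  simp only [← Fintype.sum_prod_type']
  exact Fintype.sum_equiv ⟨fun z => (z.2.2.1, z.1, z.2.2.2, z.2.1),
    fun z => (z.2.1, z.2.2.2, z.1, z.2.2.1), fun _ => rfl, fun _ => rfl⟩ _ _ fun z => rfl

/-- The matrix with entries `a i j k l` at `((i, k), (j, l))`. -/
def unblock (a : Matrix ι ι (Matrix κ κ ℂ)) : Matrix (ι × κ) (ι × κ) ℂ :=
  Matrix.of fun p q => a p.1 q.1 p.2 q.2

/-- If `x` is a matrix over `M_κ` then `∑ y t r ⊗ conj (y t r)`, where `y = Rᴴ x P`, has norm at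
most `‖x‖² ‖R Rᴴ‖₂ ‖P Pᴴ‖₂`. -/
lemma norm_gram_ofFamily_comb_le (a : Matrix ι ι (Matrix κ κ ℂ)) (R P : Matrix ι ι ℂ) :
    ‖gram (ofFamily fun s : ι × ι => ∑ i, ∑ j, (conj (R i s.1) * P j s.2) • a i j)
      (ofFamily fun s : ι × ι => ∑ i, ∑ j, (conj (R i s.1) * P j s.2) • a i j)‖ ≤
      ‖unblock a‖ ^ 2 *
        (√(∑ i, ∑ j, ‖(R * Rᴴ) i j‖ ^ 2) * √(∑ i, ∑ j, ‖(P * Pᴴ) i j‖ ^ 2)) := by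
  refine norm_gram_self_le_of_sum_comb_sq_le _ (by positivity) fun R' P' => ?_
  -- Compressing by `R, P` on the outer indices and then by `R', P'` on the inner ones is one
  -- compression by Kronecker products, whose Hilbert-Schmidt norms multiply.
  have h := sum_comb_sq_le (unblock a) (R ⊗ₖ R') (P ⊗ₖ P')
  rw [conjTranspose_kronecker, conjTranspose_kronecker, ← mul_kronecker_mul, ← mul_kronecker_mul,
    sum_kronecker_sq, sum_kronecker_sq, Real.sqrt_mul (by positivity),
    Real.sqrt_mul (by positivity)] at h
  have e : ∀ t' r' t r, comb (R ⊗ₖ R') (P ⊗ₖ P') (unblock a) (t, t') (r, r') =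
      (comb R' P' (ofFamily fun s : ι × ι => ∑ i, ∑ j, (conj (R i s.1) * P j s.2) • a i j)
        t' r').ofLp (t, r) := fun t' r' t r => by
    simp only [comb, unblock, ofFamily, Fintype.sum_prod_type, kroneckerMap_apply, map_mul,
      of_apply, smul_eq_mul, WithLp.ofLp_sum, WithLp.ofLp_smul, Finset.sum_apply, Pi.smul_apply,
      Matrix.sum_apply, Matrix.smul_apply, Finset.mul_sum]
    simp only [← Fintype.sum_prod_type']
    exact Fintype.sum_equiv ⟨fun z => (z.2.1, z.2.2.2, z.1, z.2.2.1),
      fun z => (z.2.2.1, z.1, z.2.2.2, z.2.1), fun _ => rfl, fun _ => rfl⟩ _ _ fun z => by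
        simp only [Equiv.coe_fn_mk]; ring
  rw [sum_norm_sq_eq_of_coord _ _ e]
  refine h.trans ?_
  calc _ ≤ ‖unblock a‖ ^ 2 * _ := mul_le_mul_of_nonneg_right (norm_gram_scalar_le _) (by positivity)
    _ = _ := by ring

end Comb

end OperatorSpaceAux

/-! ### Completely bounded and `(2,oh)`-summing maps. -/

section CompletelyBounded

open Matrix hiding gram
open OperatorSpaceAux
open scoped Matrix.Norms.L2Operator Kronecker InnerProductSpace
open OperatorSpace (matNorm)

variable {E F G : Type*} [NormedAddCommGroup E] [NormedSpace ℂ E] [OperatorSpace E]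
  [NormedAddCommGroup F] [NormedSpace ℂ F] [OperatorSpace F]
  [NormedAddCommGroup G] [NormedSpace ℂ G] [OperatorSpace G]

/-- `u` is completely bounded with constant `C`. -/
def IsCBBound (u : E →ₗ[ℂ] F) (C : ℝ≥0) : Prop :=
  ∀ (n : ℕ) (x : Matrix (Fin n) (Fin n) E), matNorm n (x.map u) ≤ C * matNorm n x

/-- `w` is `(2, oh)`-summing with constant `C`. -/
def IsPi2ohBound {Y : Type*} [NormedAddCommGroup Y] [NormedSpace ℂ Y] (w : E →ₗ[ℂ] Y)
    (C : ℝ≥0) : Prop :=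
  ∀ (n : ℕ) (x : Fin n → E),
    ∑ i, ‖w (x i)‖ₑ ^ 2 ≤ (C : ℝ≥0∞) ^ 2 * minNorm (∑ i, x i ⊗ₜ[ℂ] Conj.mk (x i))

/-- The infimum is attained: the defining inequalities survive letting the constant decrease to `C`.
-/
lemma cbNorm_le_coe_iff {u : E →ₗ[ℂ] F} {C : ℝ≥0} : cbNorm u ≤ C ↔ IsCBBound u C := by
  refine ⟨fun h n x => ?_, fun h => iInf₂_le C h⟩
  have h1 : ∀ C' : ℝ≥0, C < C' → matNorm n (x.map u) ≤ C' * matNorm n x := fun C' hC' => by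
    have h2 : cbNorm u < C' := h.trans_lt (by exact_mod_cast hC')
    simp only [cbNorm, iInf_lt_iff] at h2
    obtain ⟨D, hD, hDC⟩ := h2
    refine (hD n x).trans (mul_le_mul_of_nonneg_right ?_ (apply_nonneg _ _))
    exact_mod_cast hDC.le
  refine le_of_forall_pos_le_add fun ε hε => ?_
  have h0 : 0 ≤ matNorm n x := apply_nonneg _ _
  have h3 := h1 (C + Real.toNNReal (ε / (matNorm n x + 1)))
    (lt_add_of_pos_right _ (Real.toNNReal_pos.mpr (by positivity)))
  refine h3.trans ?_
  rw [NNReal.coe_add, Real.coe_toNNReal _ (by positivity), add_mul]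
  gcongr
  rw [div_mul_eq_mul_div, div_le_iff₀ (by positivity)]
  nlinarith

lemma exists_isPi2ohBound_of_lt {Y : Type*} [NormedAddCommGroup Y] [NormedSpace ℂ Y]
    {w : E →ₗ[ℂ] Y} {c : ℝ≥0∞} (h : pi2oh w < c) :
    ∃ C : ℝ≥0, C < c ∧ IsPi2ohBound w C := by
  simp only [pi2oh, iInf_lt_iff] at h
  obtain ⟨D, hD, hDC⟩ := h
  exact ⟨D, hDC, hD⟩

lemma IsCBBound.norm_le {u : E →ₗ[ℂ] F} {C : ℝ≥0} (h : IsCBBound u C) (x : E) :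
    ‖u x‖ ≤ C * ‖x‖ := by
  have h1 := h 1 (Matrix.of fun _ _ => x)
  rw [OperatorSpace.matNorm_one] at h1
  rw [← OperatorSpace.matNorm_one (u x)]
  exact h1

lemma IsCBBound.comp {v : F →ₗ[ℂ] G} {u : E →ₗ[ℂ] F} {C D : ℝ≥0} (hv : IsCBBound v C)
    (hu : IsCBBound u D) : IsCBBound (v ∘ₗ u) (C * D) := fun n x => by
  have h1 := hv n (x.map u)
  rw [NNReal.coe_mul, mul_assoc]
  exact h1.trans (mul_le_mul_of_nonneg_left (hu n x) C.2)

lemma IsCBBound.add {u v : E →ₗ[ℂ] F} {C D : ℝ≥0} (hu : IsCBBound u C)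
    (hv : IsCBBound v D) : IsCBBound (u + v) (C + D) := fun n x => by
  have h1 : x.map (u + v) = x.map u + x.map v := by ext; simp
  rw [h1, NNReal.coe_add, add_mul]
  exact (map_add_le_add _ _ _).trans (add_le_add (hu n x) (hv n x))

lemma IsCBBound.neg {u : E →ₗ[ℂ] F} {C : ℝ≥0} (hu : IsCBBound u C) : IsCBBound (-u) C :=
  fun n x => by
    have h1 : x.map (-u) = -x.map u := by ext; simp
    rw [h1, map_neg_eq_map]
    exact hu n x

lemma IsCBBound.mono {u : E →ₗ[ℂ] F} {C D : ℝ≥0} (hu : IsCBBound u C) (h : C ≤ D) :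
    IsCBBound u D := fun n x =>
  (hu n x).trans (mul_le_mul_of_nonneg_right (NNReal.coe_le_coe.mpr h) (apply_nonneg _ _))

lemma IsCBBound.pow {u : E →ₗ[ℂ] E} {C : ℝ≥0} (hu : IsCBBound u C) (m : ℕ) :
    IsCBBound (u ^ m) (C ^ m) := by
  induction m with
  | zero => intro n x; simp [Module.End.one_eq_id]
  | succ m ih => rw [pow_succ, pow_succ]; exact ih.comp hu

/-- If `D` has finite rank and `‖D‖_cb ≤ q < 1` then `1 - D` has an inverse of completely bounded
norm at most `1 / (1 - q)`. -/
lemma IsCBBound.exists_inverse_one_sub {D : E →ₗ[ℂ] E} {q : ℝ≥0} (hD : IsCBBound D q)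
    (hq : q < 1) [FiniteDimensional ℂ (LinearMap.range D)] :
    ∃ V : E →ₗ[ℂ] E, (∀ x, V (x - D x) = x) ∧ IsCBBound V (1 - q)⁻¹ := by
  have hinj : ∀ x, x - D x = 0 → x = 0 := fun x hx => by
    have h1 := hD.norm_le x
    rw [← sub_eq_zero.mp hx] at h1
    have h2 : (q : ℝ) < 1 := by exact_mod_cast hq
    have h3 : ‖x‖ ≤ 0 := by nlinarith [norm_nonneg x]
    exact norm_le_zero_iff.mp h3
  -- `E` need not be complete, so no Neumann series is used. The injective map `1 - D` preserves the
  -- finite-dimensional range of `D`, hence is onto there; solving `(1 - D) z = D y` gives `(1 -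
  -- D)(y + z) = y`.
  have hsurj : Function.Surjective ((1 : Module.End ℂ E) - D) := by
    let f : LinearMap.range D →ₗ[ℂ] LinearMap.range D :=
      ((1 : Module.End ℂ E) - D).restrict fun x hx =>
        Submodule.sub_mem _ hx ⟨x, rfl⟩
    have hf : Function.Injective f := by
      rw [injective_iff_map_eq_zero]
      intro x hx
      exact Subtype.ext (hinj x (congrArg Subtype.val hx))
    have hf' := LinearMap.injective_iff_surjective.mp hf
    intro y
    obtain ⟨z, hz⟩ := hf' ⟨D y, y, rfl⟩
    have hz' : (z : E) - D z = D y := congrArg Subtype.val hz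
    refine ⟨y + z, ?_⟩
    simp only [LinearMap.sub_apply, Module.End.one_apply, map_add]
    rw [← hz']
    abel
  have hinj' : Function.Injective ((1 : Module.End ℂ E) - D) := by
    rw [injective_iff_map_eq_zero]
    exact hinj
  let e := LinearEquiv.ofBijective ((1 : Module.End ℂ E) - D) ⟨hinj', hsurj⟩
  refine ⟨e.symm, fun x => e.symm_apply_apply x, fun n x => ?_⟩
  obtain ⟨y, rfl⟩ : ∃ y : Matrix (Fin n) (Fin n) E, x = y - y.map D := by
    refine ⟨x.map e.symm, ?_⟩
    ext i j
    exact (e.apply_symm_apply (x i j)).symm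
  have h1 : (y - y.map D).map (e.symm : E →ₗ[ℂ] E) = y := by
    ext i j
    exact e.symm_apply_apply (y i j)
  rw [h1, NNReal.coe_inv, NNReal.coe_sub hq.le, NNReal.coe_one]
  have h2 : 0 < 1 - (q : ℝ) := sub_pos.mpr (by exact_mod_cast hq)
  rw [inv_mul_eq_div, le_div_iff₀ h2]
  have h3 := hD n y
  have h4 : matNorm n y ≤ matNorm n (y - y.map D) + matNorm n (y.map D) := by
    refine le_trans (le_of_eq ?_) (map_add_le_add (matNorm n) (y - y.map D) (y.map D))
    rw [sub_add_cancel]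
  linarith

/-- Bounded operators between operator Hilbert spaces are completely bounded, with the same
norm. -/
lemma isCBBound_of_norm_le {I J : Type*} {A : OH I →ₗ[ℂ] OH J} {c : ℝ≥0}
    (hA : ∀ x, ‖A x‖ ≤ c * ‖x‖) : IsCBBound A c := fun n x => by
  change √‖gram (x.map A) (x.map A)‖ ≤ c * √‖gram x x‖
  rw [Real.sqrt_le_left (by positivity), mul_pow, Real.sq_sqrt (norm_nonneg _)]
  exact norm_gram_map_le A hA x

/-- The composition of the conjugate of `ψ` with entrywise conjugation. -/
def conjLift {q : ℕ} (ψ : Conj E →ₗ[ℂ] Matrix (Fin q) (Fin q) ℂ) :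
    E →ₗ[ℂ] Matrix (Fin q) (Fin q) ℂ where
  toFun y := (ψ (Conj.mk y)).map conj
  map_add' x y := by
    have : ψ (Conj.mk (x + y)) = ψ (Conj.mk x) + ψ (Conj.mk y) := map_add ψ _ _
    rw [this]
    ext; simp
  map_smul' c x := by
    have : ψ (Conj.mk (c • x)) = conj c • ψ (Conj.mk x) := by
      rw [← map_smul, Conj.smul_mk, Complex.conj_conj]
    rw [this]
    ext; simp

lemma IsCBBound.conjLift {q : ℕ} {ψ : Conj E →ₗ[ℂ] Matrix (Fin q) (Fin q) ℂ} {C : ℝ≥0}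
    (h : IsCBBound ψ C) : IsCBBound (conjLift ψ) C := fun n x => by
  refine le_trans (le_of_eq ?_) (h n x)
  exact norm_map_conj (flatten (Matrix.map (β := Matrix (Fin q) (Fin q) ℂ)
    (show Matrix (Fin n) (Fin n) (Conj E) from x) ψ))

/-- For a symmetric tensor `∑ x ⊗ x̄`, the Cauchy-Schwarz inequality `norm_gram_le` reduces pairs
`(φ, ψ)` to the diagonal pairs given by `φ` and by `conjLift ψ`. -/
lemma minNorm_sum_le {τ : Type*} [Fintype τ] (x : τ → E) {C : ℝ≥0}
    (h : ∀ (p : ℕ) (φ : E →ₗ[ℂ] Matrix (Fin p) (Fin p) ℂ), IsCBBound φ 1 →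
      ‖gram (ofFamily fun s => φ (x s)) (ofFamily fun s => φ (x s))‖ ≤ C) :
    minNorm (∑ s, x s ⊗ₜ[ℂ] Conj.mk (x s)) ≤ C := by
  refine iSup_le fun p => iSup_le fun q => iSup_le fun φ => iSup_le fun ψ => iSup_le fun hφ =>
    iSup_le fun hψ => ?_
  replace hφ : IsCBBound φ 1 := cbNorm_le_coe_iff.mp hφ
  replace hψ : IsCBBound ψ 1 := cbNorm_le_coe_iff.mp hψ
  have e : TensorProduct.lift ((Matrix.kroneckerBilinear (l := Fin p) (m := Fin p) (n := Fin q)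
      (p := Fin q) (R := ℂ) (α := ℂ)).compl₁₂ φ ψ) (∑ s, x s ⊗ₜ[ℂ] Conj.mk (x s)) =
      gram (ofFamily fun s => φ (x s)) (ofFamily fun s => conjLift ψ (x s)) := by
    rw [gram_ofFamily, map_sum]
    refine Finset.sum_congr rfl fun s _ => ?_
    rw [TensorProduct.lift.tmul]
    change φ (x s) ⊗ₖ ψ (Conj.mk (x s)) = φ (x s) ⊗ₖ ((ψ (Conj.mk (x s))).map conj).map conj
    congr 1
    ext; simp
  rw [e, ← ofReal_norm, ← ENNReal.ofReal_coe_nnreal]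
  refine ENNReal.ofReal_le_ofReal ?_
  refine (norm_gram_le _ _).trans ?_
  rw [← Real.mul_self_sqrt C.coe_nonneg]
  gcongr
  · exact h p φ hφ
  · exact h q _ hψ.conjLift

lemma IsPi2ohBound.sum_le {Y : Type*} [NormedAddCommGroup Y] [NormedSpace ℂ Y] {w : E →ₗ[ℂ] Y}
    {C : ℝ≥0} (hw : IsPi2ohBound w C) {τ : Type*} [Fintype τ] (x : τ → E) {D : ℝ≥0}
    (h : ∀ (p : ℕ) (φ : E →ₗ[ℂ] Matrix (Fin p) (Fin p) ℂ), IsCBBound φ 1 →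
      ‖gram (ofFamily fun s => φ (x s)) (ofFamily fun s => φ (x s))‖ ≤ D) :
    ∑ s, ‖w (x s)‖ ^ 2 ≤ C ^ 2 * D := by
  let e := Fintype.equivFin τ
  have h1 := hw (Fintype.card τ) (x ∘ e.symm)
  have h2 : ∑ i, ‖w ((x ∘ e.symm) i)‖ₑ ^ 2 = ∑ s, ‖w (x s)‖ₑ ^ 2 :=
    e.symm.sum_comp fun s => ‖w (x s)‖ₑ ^ 2
  have h3 : ∑ i, (x ∘ e.symm) i ⊗ₜ[ℂ] Conj.mk ((x ∘ e.symm) i) =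
      ∑ s, x s ⊗ₜ[ℂ] Conj.mk (x s) := e.symm.sum_comp fun s => x s ⊗ₜ[ℂ] Conj.mk (x s)
  rw [h2, h3] at h1
  have h4 := h1.trans (mul_le_mul_right (minNorm_sum_le x h) _)
  have h5 : ∑ s, ‖w (x s)‖₊ ^ 2 ≤ C ^ 2 * D := by
    simp only [enorm_eq_nnnorm] at h4
    exact_mod_cast h4
  have h6 := NNReal.coe_le_coe.mpr h5
  push_cast at h6
  exact h6

/-- A `(2, oh)`-summing map into an operator Hilbert space is completely bounded. -/
lemma IsPi2ohBound.isCBBound {I : Type*} {w : E →ₗ[ℂ] OH I} {C : ℝ≥0} (hw : IsPi2ohBound w C) :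
    IsCBBound w C := fun n x => by
  change √‖gram (x.map w) (x.map w)‖ ≤ C * matNorm n x
  have h0 : 0 ≤ matNorm n x := apply_nonneg _ _
  rw [Real.sqrt_le_left (by positivity), mul_pow]
  refine norm_gram_self_le_of_sum_comb_sq_le _ (by positivity) fun R P => ?_
  let c : ℝ := √(∑ i, ∑ j, ‖(R * Rᴴ) i j‖ ^ 2) * √(∑ i, ∑ j, ‖(P * Pᴴ) i j‖ ^ 2)
  have hc : 0 ≤ c := by positivity
  -- The summing inequality is applied to the entries of `Rᴴ x P`, whose images under `w` are the
  -- entries of `Rᴴ (w x) P`; `norm_gram_ofFamily_comb_le` controls their minimal tensor norm.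
  have h := hw.sum_le (τ := Fin n × Fin n)
    (fun s => ∑ i, ∑ j, (conj (R i s.1) * P j s.2) • x i j)
    (D := Real.toNNReal (matNorm n x ^ 2 * c)) fun p φ hφ => by
      simp only [map_sum, map_smul]
      refine (norm_gram_ofFamily_comb_le (x.map φ) R P).trans ?_
      rw [Real.coe_toNNReal _ (by positivity)]
      refine mul_le_mul_of_nonneg_right ?_ hc
      refine pow_le_pow_left₀ (norm_nonneg _) ?_ 2
      have := hφ n x
      rwa [NNReal.coe_one, one_mul] at this
  rw [Fintype.sum_prod_type, Real.coe_toNNReal _ (by positivity)] at h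
  have e : ∀ t r, comb R P (x.map w) t r =
      w (∑ i, ∑ j, (conj (R i t) * P j r) • x i j) := fun t r => by
    simp [comb]
  simp only [e]
  exact h.trans_eq (by ring)

/-- If `v : OH → E` is completely bounded and `w` is `(2, oh)`-summing then `w v` is
Hilbert-Schmidt. -/
lemma IsPi2ohBound.sum_comp_le {I : Type*} {Y : Type*} [NormedAddCommGroup Y] [NormedSpace ℂ Y]
    {w : E →ₗ[ℂ] Y} {C : ℝ≥0} (hw : IsPi2ohBound w C) {v : OH I →ₗ[ℂ] E} {D : ℝ≥0}
    (hv : IsCBBound v D) {τ : Type*} [Fintype τ] [DecidableEq τ] {f : τ → OH I}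
    (hf : Orthonormal ℂ f) : ∑ s, ‖w (v (f s))‖ ^ 2 ≤ C ^ 2 * D ^ 2 := by
  have h := hw.sum_le (fun s => v (f s)) (D := D ^ 2) fun p φ hφ => by
    let a : τ → Matrix (Fin p) (Fin p) ℂ := fun s => φ (v (f s))
    -- With `N = ‖∑ a s ⊗ conj (a s)‖`, this test matrix has `OH` norm `√N` while its image under `φ
    -- v` has norm `N`. So `N ≤ D √N`, that is, `N ≤ D²`.
    let X : Matrix (Fin p) (Fin p) (OH I) := Matrix.of fun k l => ∑ s, conj (a s k l) • f s
    have h1 : gram X X = (gram (ofFamily a) (ofFamily a)).map conj := by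
      ext r s
      simp [gram, X, ofFamily,
        orthonormal_iff_ite.mp hf, PiLp.inner_apply]
    have h2 : flatten ((X.map v).map φ) = (gram (ofFamily a) (ofFamily a)).map conj := by
      ext r s
      simp [flatten, gram, X, ofFamily, PiLp.inner_apply, Matrix.sum_apply, a]
    have h3 := (hφ.comp hv) p X
    have h4 : matNorm p (X.map (φ ∘ₗ v)) = ‖flatten ((X.map v).map φ)‖ := rfl
    have h5 : matNorm p X = √‖gram X X‖ := rfl
    rw [h4, h2, h5, h1, norm_map_conj, one_mul] at h3
    change ‖gram (ofFamily a) (ofFamily a)‖ ≤ (D : ℝ) ^ 2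
    set N := ‖gram (ofFamily a) (ofFamily a)‖
    have hN : 0 ≤ N := norm_nonneg _
    rcases hN.eq_or_lt with h0 | h0
    · rw [← h0]; positivity
    · have h6 : √N * √N ≤ D * √N := by rwa [Real.mul_self_sqrt hN]
      have h7 := le_of_mul_le_mul_right h6 (Real.sqrt_pos.mpr h0)
      have h8 := pow_le_pow_left₀ (Real.sqrt_nonneg _) h7 2
      rwa [Real.sq_sqrt hN] at h8
  rwa [NNReal.coe_pow] at h

end CompletelyBounded

/-! ### Low rank approximation of `T^(m+1)`, and the choice of constants. -/

section Approximation

open OperatorSpace (matNorm)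

universe u

variable {E : Type u} [NormedAddCommGroup E] [NormedSpace ℂ E] [OperatorSpace E]

/-- Since `T^(m+1) = v (w v)^m w`, the approximation is made on the Hilbert space in the middle; the
outer factors `a` and `b` are the cb bounds of `v` and `w`. -/
lemma IsPi2ohBound.exists_finrank_range_lt_approx_pow {I : Type*} {T : E →ₗ[ℂ] E}
    {w : E →ₗ[ℂ] OH I} {v : OH I →ₗ[ℂ] E} (hT : v ∘ₗ w = T)
    [FiniteDimensional ℂ (LinearMap.range T)] {a b : ℝ≥0} (hw : IsPi2ohBound w b)
    (hv : IsCBBound v a) {N m : ℕ} (hN : 0 < N) (hm : 0 < m) :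
    ∃ S : E →ₗ[ℂ] E, FiniteDimensional ℂ (LinearMap.range S) ∧
      Module.finrank ℂ (LinearMap.range S) < N ∧
      IsCBBound (T ^ (m + 1) - S) (a * ((a * b / NNReal.sqrt N) ^ m * b)) := by
  have hTx : ∀ x, v (w x) = T x := fun x => LinearMap.congr_fun hT x
  -- Off the range of `w` the map `v` is arbitrary, so `w v` may have infinite rank. Precomposing
  -- with the projection onto the closure of that range leaves `T` unchanged and puts the range of
  -- `A` inside the finite-dimensional, hence closed, space `w (range T)`.
  let X := (LinearMap.range w).topologicalClosure
  have : CompleteSpace X := (LinearMap.range w).isClosed_topologicalClosure.completeSpace_coe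
  let P : OH I →L[ℂ] OH I := X.starProjection
  have hP : ∀ x, P (w x) = w x := fun x =>
    Submodule.starProjection_eq_self_iff.mpr (Submodule.le_topologicalClosure _ ⟨x, rfl⟩)
  have hP1 : ∀ z, ‖P z‖ ≤ (1 : ℝ≥0) * ‖z‖ := fun z => by
    rw [NNReal.coe_one, one_mul]
    exact X.norm_starProjection_apply_le z
  let A₀ : OH I →L[ℂ] OH I := (w ∘ₗ v).mkContinuous (b * a) fun z => by
    have := (hw.isCBBound.comp hv).norm_le z
    rwa [NNReal.coe_mul] at this
  let A : OH I →L[ℂ] OH I := A₀ ∘L P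
  have hA : ∀ z, A z = w (v (P z)) := fun z => rfl
  have hvP : IsCBBound (v ∘ₗ (P : OH I →ₗ[ℂ] OH I)) a := by
    have := hv.comp (isCBBound_of_norm_le (A := (P : OH I →ₗ[ℂ] OH I)) hP1)
    rwa [mul_one] at this
  let G : Submodule ℂ (OH I) := (LinearMap.range T).map w
  have hG : IsClosed (G : Set (OH I)) := G.closed_of_finiteDimensional
  have hrange : LinearMap.range (A : OH I →ₗ[ℂ] OH I) ≤ G := by
    rintro _ ⟨z, rfl⟩
    have h1 : closure (LinearMap.range w : Set (OH I)) ⊆ A₀ ⁻¹' G := by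
      refine closure_minimal ?_ (hG.preimage A₀.continuous)
      rintro _ ⟨x, rfl⟩
      exact ⟨T x, ⟨x, rfl⟩, by rw [← hTx]; rfl⟩
    exact h1 (X.starProjection_apply_mem z)
  have : FiniteDimensional ℂ (LinearMap.range (A : OH I →ₗ[ℂ] OH I)) :=
    Submodule.finiteDimensional_of_le hrange
  obtain ⟨B, hBfin, hBrank, hB⟩ := _root_.exists_finrank_range_lt_approx_pow A
    (c := (b : ℝ) ^ 2 * a ^ 2) (by positivity) hN (fun f hf => hw.sum_comp_le hvP hf) hm
  have hAw : ∀ j x, (A ^ j) (w x) = w ((T ^ j) x) := fun j => by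
    induction j with
    | zero => intro x; rfl
    | succ j ih =>
      intro x
      rw [pow_succ, pow_succ]
      change (A ^ j) (A (w x)) = w ((T ^ j) (T x))
      rw [hA, hP, hTx, ih]
  have hrangeS : LinearMap.range (v ∘ₗ B ∘ₗ w) ≤ (LinearMap.range B).map v := by
    rintro _ ⟨x, rfl⟩
    exact ⟨B (w x), ⟨w x, rfl⟩, rfl⟩
  refine ⟨v ∘ₗ B ∘ₗ w, Submodule.finiteDimensional_of_le hrangeS, ?_, ?_⟩
  · exact ((Submodule.finrank_mono hrangeS).trans (Submodule.finrank_map_le _ _)).trans_lt hBrank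
  · have e : T ^ (m + 1) - v ∘ₗ B ∘ₗ w =
        v ∘ₗ (((A ^ m : OH I →L[ℂ] OH I) : OH I →ₗ[ℂ] OH I) - B) ∘ₗ w := by
      ext x
      have h1 : (T ^ (m + 1)) x = v (w ((T ^ m) x)) := by
        rw [hTx, pow_succ']
        rfl
      rw [LinearMap.sub_apply, h1, ← hAw]
      exact (map_sub v _ _).symm
    rw [e]
    refine hv.comp (IsCBBound.comp (isCBBound_of_norm_le fun z => (hB z).trans_eq ?_)
      hw.isCBBound)
    congr 1
    push_cast
    congr 1
    rw [← mul_pow, Real.sqrt_div (by positivity), Real.sqrt_sq (by positivity), mul_comm (b : ℝ)]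

/-- The delicate point is the product `0 · ∞`. If `‖v‖_cb = 0` then `v = 0`; if `‖v‖_cb = ∞` then
`π_{2,oh}(w) = 0`, so `w = 0`. Both contradict `T ≠ 0`; otherwise one can divide by `‖v‖_cb`. -/
lemma exists_bounds_of_delta_lt {T : E →ₗ[ℂ] E} (hT : T ≠ 0) {c : ℝ≥0}
    (h : delta T < c) : ∃ (I : Type u) (w : E →ₗ[ℂ] OH I) (v : OH I →ₗ[ℂ] E) (a b : ℝ≥0),
      v ∘ₗ w = T ∧ IsCBBound v a ∧ IsPi2ohBound w b ∧ a * b ≤ c := by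
  simp only [delta, iInf_lt_iff] at h
  obtain ⟨I, w, v, hvw, h⟩ := h
  have hv0 : cbNorm v ≠ 0 := fun h0 => by
    have h1 : IsCBBound v 0 := cbNorm_le_coe_iff.mp h0.le
    refine hT (hvw.symm.trans ?_)
    ext x
    simpa using h1.norm_le (w x)
  have hvtop : cbNorm v ≠ ∞ := fun h0 => by
    have hw0 : pi2oh w = 0 := by
      by_contra hne
      rw [h0, ENNReal.top_mul hne] at h
      exact not_top_lt h
    have hw1 : cbNorm w ≤ 0 := by
      refine le_of_forall_gt fun ε hε => ?_
      rw [← hw0] at hε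
      obtain ⟨D, hD, hDw⟩ := exists_isPi2ohBound_of_lt hε
      exact (cbNorm_le_coe_iff.mpr hDw.isCBBound).trans_lt hD
    have h1 : IsCBBound w 0 := cbNorm_le_coe_iff.mp hw1
    refine hT (hvw.symm.trans ?_)
    ext x
    have : w x = 0 := by simpa using h1.norm_le x
    simp [this]
  have h1 : pi2oh w < c / cbNorm v :=
    (ENNReal.lt_div_iff_mul_lt (Or.inl hv0) (Or.inl hvtop)).mpr (by rwa [mul_comm])
  obtain ⟨b, hb, hwb⟩ := exists_isPi2ohBound_of_lt h1
  have h2 := (ENNReal.lt_div_iff_mul_lt (Or.inl hv0) (Or.inl hvtop)).mp hb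
  refine ⟨I, w, v, (cbNorm v).toNNReal, b, hvw,
    cbNorm_le_coe_iff.mp (ENNReal.coe_toNNReal hvtop).ge, hwb, ?_⟩
  rw [← ENNReal.coe_le_coe, ENNReal.coe_mul, ENNReal.coe_toNNReal hvtop, mul_comm]
  exact h2.le

/-- Raising the hypothesis to the power `m/2` gives `m c^(m+1) ≤ (√N)^m`; this is where the
exponents `2/m` and `2 + 2/m` come from. -/
lemma mul_div_sqrt_pow_le {c : ℝ≥0} {m N : ℕ} (hm : 0 < m) (hN : 0 < N)
    (h : (m : ℝ≥0) ^ (2 / (m : ℝ)) * c ^ (2 + 2 / (m : ℝ)) ≤ N) :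
    c * (c / NNReal.sqrt N) ^ m ≤ (m : ℝ≥0)⁻¹ := by
  have hm' : (m : ℝ) ≠ 0 := by exact_mod_cast hm.ne'
  have h1 := NNReal.rpow_le_rpow h (z := (m : ℝ) / 2) (by positivity)
  have e1 : (2 / (m : ℝ)) * (m / 2) = 1 := by field_simp
  have e2 : (2 + 2 / (m : ℝ)) * (m / 2) = ((m + 1 : ℕ) : ℝ) := by push_cast; field_simp
  have e3 : (N : ℝ≥0) ^ ((m : ℝ) / 2) = NNReal.sqrt N ^ m := by
    rw [NNReal.sqrt_eq_rpow, ← NNReal.rpow_natCast, ← NNReal.rpow_mul]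
    congr 1
    ring
  rw [NNReal.mul_rpow, ← NNReal.rpow_mul, ← NNReal.rpow_mul, e1, e2, e3, NNReal.rpow_one,
    NNReal.rpow_natCast] at h1
  have hs : 0 < NNReal.sqrt N ^ m := pow_pos (NNReal.sqrt_pos.mpr (by exact_mod_cast hN)) m
  have hm0 : (0 : ℝ≥0) < m := by exact_mod_cast hm
  rw [div_pow, mul_div_assoc', ← pow_succ', div_le_iff₀ hs, inv_mul_eq_div, le_div_iff₀ hm0,
    mul_comm]
  exact h1

/-- Since `δ` is an infimum, a factorization is available only with constant slightly above `k n`;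
continuity absorbs this loss. -/
lemma exists_gt_mul_rpow_lt {c t R : ℝ≥0} {s : ℝ} (hs : 0 ≤ s) (h : t * c ^ s < R) :
    ∃ c', c < c' ∧ t * c' ^ s < R := by
  have hcont : Continuous fun x : ℝ≥0 => t * x ^ s :=
    continuous_const.mul (NNReal.continuous_rpow_const hs)
  have h1 : ∀ᶠ x in nhdsWithin c (Set.Ioi c), t * x ^ s < R :=
    nhdsWithin_le_nhds (hcont.continuousAt.eventually (gt_mem_nhds h))
  obtain ⟨x, hx, hx'⟩ := (h1.and self_mem_nhdsWithin).exists
  exact ⟨x, hx', hx⟩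

end Approximation

/-! ### Perturbation of the low rank approximant to a map fixing `M`. -/

theorem mainTheorem2 {E : Type*} [NormedAddCommGroup E] [NormedSpace ℂ E] [OperatorSpace E]
    (K : ℝ) (k : ℕ → ℝ≥0) (h : HasDeltaOUAP E K k) (m : ℕ) (hm : 1 < m) :
    HasOUAP E (1 / (1 - 1 / (m : ℝ)) * (1 / (m : ℝ) + K ^ (m + 1)))
      (fun n => (m : ℝ≥0) ^ (2 / (m : ℝ)) * k n ^ (2 + 2 / (m : ℝ))) := by
  obtain ⟨hK, h⟩ := h
  have hm0 : 0 < m := zero_lt_one.trans hm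
  have hmR : (1 : ℝ) < m := by exact_mod_cast hm
  have hinv : 1 / (m : ℝ) < 1 := by rw [div_lt_one (by positivity)]; exact hmR
  have hinv0 : 0 < 1 / (m : ℝ) := by positivity
  have hsub : 0 < 1 - 1 / (m : ℝ) := sub_pos.mpr hinv
  refine ⟨?_, fun n M hM hMn => ?_⟩
  · rw [one_div_mul_eq_div, le_div_iff₀ hsub]
    have := one_le_pow₀ hK (n := m + 1)
    linarith
  obtain ⟨T, hTfin, hTK, hTδ, hTM⟩ := h n M hM hMn
  by_cases hT : T = 0
  · have h0 : LinearMap.range (0 : E →ₗ[ℂ] E) = ⊥ := LinearMap.range_zero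
    refine ⟨0, ?_, ?_, ?_, fun x hx => ?_⟩
    · rw [h0]
      infer_instance
    · refine (cbNorm_le_coe_iff (C := 0).mpr fun n x => ?_).trans (by simp)
      have : x.map (0 : E →ₗ[ℂ] E) = 0 := by ext; simp
      rw [this, map_zero]
      simp
    · rw [h0, finrank_bot, Nat.cast_zero]
      exact zero_le
    · rw [← hT]
      exact hTM x hx
  set R : ℝ≥0 := (m : ℝ≥0) ^ (2 / (m : ℝ)) * k n ^ (2 + 2 / (m : ℝ)) with hR
  -- With `N = ⌊R⌋₊ + 1`, the strict inequality `R < N` leaves room to enlarge `k n`, while rank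
  -- less than `N` still means rank at most `⌊R⌋₊ ≤ R`.
  have hfloor : R < ((⌊R⌋₊ + 1 : ℕ) : ℝ≥0) := by
    push_cast
    exact Nat.lt_floor_add_one R
  obtain ⟨c, hc, hcR⟩ := exists_gt_mul_rpow_lt (by positivity) hfloor
  obtain ⟨I, w, v, a, b, hvw, hv, hw, hab⟩ :=
    exists_bounds_of_delta_lt hT (hTδ.trans_lt (by exact_mod_cast hc))
  obtain ⟨S, hSfin, hSrank, hS⟩ :=
    hw.exists_finrank_range_lt_approx_pow hvw hv (Nat.succ_pos ⌊R⌋₊) hm0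
  have hD : IsCBBound (T ^ (m + 1) - S) (m : ℝ≥0)⁻¹ := by
    refine hS.mono (le_trans ?_ (mul_div_sqrt_pow_le hm0 (Nat.succ_pos ⌊R⌋₊) hcR.le))
    calc _ = (a * b) * (a * b / NNReal.sqrt ((⌊R⌋₊ + 1 : ℕ) : ℝ≥0)) ^ m := by ring
      _ ≤ _ := by gcongr
  have hDfin : FiniteDimensional ℂ (LinearMap.range (T ^ (m + 1) - S)) := by
    refine Submodule.finiteDimensional_of_le
      (S₂ := LinearMap.range T ⊔ LinearMap.range S) ?_
    rintro _ ⟨x, rfl⟩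
    refine Submodule.sub_mem _ (Submodule.mem_sup_left ⟨(T ^ m) x, ?_⟩)
      (Submodule.mem_sup_right ⟨x, rfl⟩)
    rw [pow_succ']
    rfl
  have hinv1 : (m : ℝ≥0)⁻¹ < 1 := inv_lt_one_of_one_lt₀ (by exact_mod_cast hm)
  obtain ⟨V, hV, hVcb⟩ := hD.exists_inverse_one_sub hinv1
  have hTcb : IsCBBound T (Real.toNNReal K) := cbNorm_le_coe_iff.mp hTK
  have hScb : IsCBBound S (Real.toNNReal K ^ (m + 1) + (m : ℝ≥0)⁻¹) := by
    have := (hTcb.pow (m + 1)).add hD.neg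
    rwa [neg_sub, add_sub_cancel] at this
  have hrange : LinearMap.range (V ∘ₗ S) = (LinearMap.range S).map V := LinearMap.range_comp _ _
  refine ⟨V ∘ₗ S, ?_, ?_, ?_, fun x hx => ?_⟩
  · rw [hrange]
    infer_instance
  · refine (cbNorm_le_coe_iff.mpr (hVcb.comp hScb)).trans ?_
    rw [ENNReal.ofReal, ENNReal.coe_le_coe, ← NNReal.coe_le_coe,
      Real.coe_toNNReal _ (by positivity)]
    push_cast [hinv1.le]
    rw [Real.coe_toNNReal _ (by positivity), one_div, one_div, add_comm]
  · rw [hrange]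
    refine le_trans ?_ (Nat.floor_le R.2)
    exact_mod_cast (Submodule.finrank_map_le _ _).trans (Nat.lt_succ_iff.mp hSrank)
  · have hpow : ∀ j : ℕ, (T ^ j) x = x := fun j => by
      induction j with
      | zero => rfl
      | succ j ih =>
        rw [pow_succ]
        change (T ^ j) (T x) = x
        rw [hTM x hx, ih]
    -- As `T^(m+1) x = x`, the vector `x - D x` is `S x`, so `V` sends `S x` back to `x`.
    have h1 := hV x
    rwa [LinearMap.sub_apply, hpow, sub_sub_cancel] at h1
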